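/- Let $p$ be a prime and let $C_p=\langle\sigma\rangle$ be the cyclic group of order $p$. For $n\ge 1$ and a commutative ring $B$ let $\sigma_n(B)\in \mathrm{GL}_n(B)$ be the single Jordan block with eigenvalue $1$ (ones on the diagonal and on the subdiagonal, zeros elsewhere). Let $M_n=\mathbb{Q}^n$ with the $\mathbb{Z}$-action in which $1\in\mathbb{Z}$ acts by $\sigma_n(\mathbb{Q})$, let $M_n(\mathbb{Z})=\mathbb{Z}^n\subset M_n$, and for $n\le p$ let $V_n=\mathbb{F}_p^n$ with the $C_p$-action in which $\sigma$ acts by $\sigma_n(\mathbb{F}_p)$. Let $r\ge 0$ and $1\le n_1,\dots,n_r\le p$, and let $\mathbb{Z}$ and $C_p$ act diagonally on $\bigotimes_k M_{n_k}$ and $\bigotimes_k V_{n_k}$ (for $r=0$ these are $\mathbb{Q}$ and $\mathbb{F}_p$ with trivial action). Let $\rho:\bigotimes_k M_{n_k}(\mathbb{Z})\to\bigotimes_k V_{n_k}$ be reduction modulo $p$, and for a subspace $N\subseteq \bigotimes_k M_{n_k}$ put $N(\mathbb{Z})=N\cap\bigotimes_k M_{n_k}(\mathbb{Z})$. Theorem.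 There are integers $a_1,\dots,a_p\ge 0$ with $V_{n_1}\otimes\cdots\otimes V_{n_r}\cong\bigoplus_{i=1}^p a_iV_i$ as $C_p$-modules. For any such $a_1,\dots,a_p$ there are a direct summand $N\cong\bigoplus_{i=1}^{p-1}a_iM_i$ of the $\mathbb{Z}$-module $M_{n_1}\otimes\cdots\otimes M_{n_r}$ (over $\mathbb{Q}$) and a direct summand $W\cong\bigoplus_{i=1}^{p-1}a_iV_i$ of the $C_p$-module $V_{n_1}\otimes\cdots\otimes V_{n_r}$ such that $\rho(N(\mathbb{Z}))=W$. Moreover, $N$ and $W$ can be chosen with decompositions $N=\bigoplus_{\alpha\in\Gamma}N_\alpha$ and $W=\bigoplus_{\alpha\in\Gamma}W_\alpha$ into indecomposable submodules, indexed by the same finite set $\Gamma$, with $\dim_{\mathbb{Q}}N_\alpha=\dim_{\mathbb{F}_p}W_\alpha$ and $\rho(N_\alpha(\mathbb{Z}))=W_\alpha$ for all $\alpha\in\Gamma$. -/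

import Mathlib

open scoped TensorProduct DirectSum

noncomputable section

namespace CyclicTensor

/-- The `n × n` matrix `σ_n(B)`: a single Jordan block with eigenvalue `1`, with ones on the
diagonal and on the subdiagonal. -/
def sigmaMatrix (B : Type*) [CommRing B] (n : ℕ) : Matrix (Fin n) (Fin n) B :=
  Matrix.of fun i j => if i = j then 1 else if (i : ℕ) = (j : ℕ) + 1 then 1 else 0

theorem det_sigmaMatrix (B : Type*) [CommRing B] (n : ℕ) : (sigmaMatrix B n).det = 1 := by
  rw [Matrix.det_of_isLowerTriangular]
  · simp [sigmaMatrix]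
  · intro i j hij
    have h : (i : ℕ) < (j : ℕ) := hij
    have h1 : i ≠ j := by rintro rfl; exact lt_irrefl _ h
    have h2 : ¬ ((i : ℕ) = (j : ℕ) + 1) := by omega
    simp [sigmaMatrix, h1, h2]

/-- `σ_n(B)` as an element of `GL_n(B)`. -/
def sigma (B : Type*) [CommRing B] (n : ℕ) : (Matrix (Fin n) (Fin n) B)ˣ :=
  Matrix.nonsingInvUnit (sigmaMatrix B n) (by rw [det_sigmaMatrix]; exact isUnit_one)

theorem sigmaMatrix_sub_one_pow_apply (B : Type*) [CommRing B] (n k : ℕ) (i j : Fin n)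
    (h : (i : ℕ) < (j : ℕ) + k) : ((sigmaMatrix B n - 1) ^ k) i j = 0 := by
  induction k generalizing i with
  | zero =>
    have h1 : i ≠ j := by rintro rfl; omega
    simp [h1]
  | succ k ih =>
    rw [pow_succ', Matrix.mul_apply]
    refine Finset.sum_eq_zero fun l _ => ?_
    by_cases hl : (i : ℕ) = (l : ℕ) + 1
    · rw [ih l (by omega), mul_zero]
    · have h0 : (sigmaMatrix B n - 1) i l = 0 := by
        by_cases hil : i = l
        · subst hil; simp [sigmaMatrix]
        · simp [sigmaMatrix, hil, hl]
      rw [h0, zero_mul]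

/-- In characteristic `p`, the matrix `σ_n` satisfies `σ_n ^ p = 1` as soon as `n ≤ p`. -/
theorem sigma_pow_eq_one (p : ℕ) [Fact p.Prime] {n : ℕ} (hn : n ≤ p) :
    sigma (ZMod p) n ^ p = 1 := by
  apply Units.ext
  have h : (sigmaMatrix (ZMod p) n - 1) ^ p = 0 := by
    ext i j
    exact sigmaMatrix_sub_one_pow_apply _ _ _ i j (by omega)
  change sigmaMatrix (ZMod p) n ^ p = 1
  rcases Nat.eq_zero_or_pos n with rfl | hpos
  · exact Subsingleton.elim _ _
  · have : Nonempty (Fin n) := ⟨⟨0, hpos⟩⟩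
    rw [sub_pow_char_of_commute p (Commute.one_right _), one_pow, sub_eq_zero] at h
    exact h

/-- The `ℤ`-module `M_n`: the space `ℚ^n` on which `k ∈ ℤ` acts through `σ_n(ℚ) ^ k`. -/
def M (n : ℕ) : Representation ℚ (Multiplicative ℤ) (Fin n → ℚ) where
  toFun k := Matrix.toLin' ((sigma ℚ n ^ k.toAdd : (Matrix (Fin n) (Fin n) ℚ)ˣ) :
    Matrix (Fin n) (Fin n) ℚ)
  map_one' := by simp; rfl
  map_mul' k l := by
    simp only [toAdd_mul, zpow_add, Units.val_mul, Matrix.toLin'_mul]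
    rfl

/-- The `C_p`-module `V_n` for `n ≤ p`, where `C_p` is `ℤ/p` written multiplicatively:
the space `𝔽_p^n` on which the residue class of `k` acts through `σ_n(𝔽_p) ^ k`. -/
def V (p : ℕ) [Fact p.Prime] (n : ℕ) (hn : n ≤ p) :
    Representation (ZMod p) (Multiplicative (ZMod p)) (Fin n → ZMod p) where
  toFun k := Matrix.toLin'
    ((sigma (ZMod p) n ^ k.toAdd.val : (Matrix (Fin n) (Fin n) (ZMod p))ˣ) :
      Matrix (Fin n) (Fin n) (ZMod p))
  map_one' := by simp; rfl
  map_mul' k l := by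
    have h : sigma (ZMod p) n ^ (k * l).toAdd.val
        = sigma (ZMod p) n ^ k.toAdd.val * sigma (ZMod p) n ^ l.toAdd.val := by
      rw [toAdd_mul, ZMod.val_add, ← pow_add]
      exact (pow_eq_pow_mod _ (sigma_pow_eq_one p hn)).symm
    rw [h, Units.val_mul, Matrix.toLin'_mul]
    rfl

/-- The tensor product of a finite family of representations, with the diagonal action. -/
def tensorRep {k G ι : Type*} [CommRing k] [Monoid G] {E : ι → Type*}
    [∀ i, AddCommGroup (E i)] [∀ i, Module k (E i)] (ρ : ∀ i, Representation k G (E i)) :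
    Representation k G (⨂[k] i, E i) where
  toFun g := PiTensorProduct.map fun i => ρ i g
  map_one' := by simp only [map_one]; exact PiTensorProduct.map_one
  map_mul' g h := by simp only [map_mul]; exact PiTensorProduct.map_mul _ _

/-- The direct sum `⊕_{i=1}^{b} a_i M_i`. -/
def sumM (b : ℕ) (a : ℕ → ℕ) :
    Representation ℚ (Multiplicative ℤ)
      (⨁ x : (Σ i : Fin b, Fin (a (i + 1))), (Fin (x.1 + 1) → ℚ)) :=
  Representation.directSum fun x : (Σ i : Fin b, Fin (a (i + 1))) => M (x.1 + 1)

/-- The direct sum `⊕_{i=1}^{b} a_i V_i`, where `b ≤ p`. -/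
def sumV (p : ℕ) [Fact p.Prime] (b : ℕ) (hb : b ≤ p) (a : ℕ → ℕ) :
    Representation (ZMod p) (Multiplicative (ZMod p))
      (⨁ x : (Σ i : Fin b, Fin (a (i + 1))), (Fin (x.1 + 1) → ZMod p)) :=
  Representation.directSum fun x : (Σ i : Fin b, Fin (a (i + 1))) =>
    V p (x.1 + 1) (le_trans x.1.isLt hb)

/-- The multilinear map sending integer vectors `v_k ∈ ℤ^{n_k}` to the pure tensor of their
images in `R^{n_k}`. -/
def castTprod (R : Type*) [CommRing R] {r : ℕ} (n : Fin r → ℕ) :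
    MultilinearMap ℤ (fun k : Fin r => Fin (n k) → ℤ) (⨂[R] k, (Fin (n k) → R)) where
  toFun v := PiTensorProduct.tprod R fun k i => ((v k i : ℤ) : R)
  map_update_add' := by
    intro _ v k x y
    have h : ∀ z : Fin (n k) → ℤ,
        (fun l i => ((Function.update v k z l i : ℤ) : R)) =
          Function.update (fun l i => ((v l i : ℤ) : R)) k fun i => ((z i : ℤ) : R) := by
      intro z
      funext l
      by_cases hl : l = k
      · subst hl; simp
      · simp [hl]
    have hxy : (fun i => (((x + y) i : ℤ) : R)) =
        (fun i => ((x i : ℤ) : R)) + fun i => ((y i : ℤ) : R) := by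
      funext i; simp
    rw [h, h, h, hxy, MultilinearMap.map_update_add]
  map_update_smul' := by
    intro _ v k c x
    have h : ∀ z : Fin (n k) → ℤ,
        (fun l i => ((Function.update v k z l i : ℤ) : R)) =
          Function.update (fun l i => ((v l i : ℤ) : R)) k fun i => ((z i : ℤ) : R) := by
      intro z
      funext l
      by_cases hl : l = k
      · subst hl; simp
      · simp [hl]
    have hcx : (fun i => (((c • x) i : ℤ) : R)) = (c : R) • fun i => ((x i : ℤ) : R) := by
      funext i; simp
    rw [h, h, hcx, MultilinearMap.map_update_smul]
    exact Int.cast_smul_eq_zsmul R c _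

/-- The canonical map from the integral tensor product `⊗_k ℤ^{n_k}` to `⊗_k R^{n_k}`
given by mapping the coordinates of all the factors into the ring `R`. For `R = ℚ` it is the
inclusion of the lattice `⊗_k M_{n_k}(ℤ)` in `⊗_k M_{n_k}`; for `R = ZMod p` it is the reduction
`ρ` modulo `p`. -/
def fromIntegral (R : Type*) [CommRing R] {r : ℕ} (n : Fin r → ℕ) :
    (⨂[ℤ] k, (Fin (n k) → ℤ)) →+ (⨂[R] k, (Fin (n k) → R)) :=
  (PiTensorProduct.lift (castTprod R n)).toAddMonoidHom

theorem fromIntegral_tprod (R : Type*) [CommRing R] {r : ℕ} (n : Fin r → ℕ)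
    (v : ∀ k, Fin (n k) → ℤ) :
    fromIntegral R n (PiTensorProduct.tprod ℤ v) =
      PiTensorProduct.tprod R fun k i => ((v k i : ℤ) : R) :=
  PiTensorProduct.lift.tprod v

/-- The lattice `N(ℤ)` of integral points of a subspace `N` of `⊗_k M_{n_k}`, that is, its
intersection with the standard lattice `⊗_k M_{n_k}(ℤ)` (regarded as a subgroup of the latter). -/
def integralPoints {r : ℕ} {n : Fin r → ℕ} (N : Submodule ℚ (⨂[ℚ] k, (Fin (n k) → ℚ))) :
    AddSubgroup (⨂[ℤ] k, (Fin (n k) → ℤ)) :=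
  N.toAddSubgroup.comap (fromIntegral ℚ n)

/-- `ρ(N(ℤ))`: the image of the lattice `N(ℤ)` under reduction modulo `p`. -/
def reduction (p : ℕ) {r : ℕ} {n : Fin r → ℕ} (N : Submodule ℚ (⨂[ℚ] k, (Fin (n k) → ℚ))) :
    AddSubgroup (⨂[ZMod p] k, (Fin (n k) → ZMod p)) :=
  (integralPoints N).map (fromIntegral (ZMod p) n)

/-- A representation is indecomposable if it is nonzero and is not the direct sum of two nonzero
subrepresentations. -/
def IsIndecomposable {k G E : Type*} [CommRing k] [Monoid G] [AddCommGroup E] [Module k E]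
    (ρ : Representation k G E) : Prop :=
  Nontrivial E ∧ ∀ A B : Subrepresentation ρ, IsCompl A B → A = ⊥ ∨ B = ⊥

/-- `N` is the internal direct sum of the family `S` of subrepresentations. -/
def IsInternalSum {k G E Γ : Type*} [CommRing k] [Monoid G] [AddCommGroup E] [Module k E]
    {ρ : Representation k G E} (S : Γ → Subrepresentation ρ) (N : Subrepresentation ρ) : Prop :=
  iSupIndep (fun γ => (S γ).toSubmodule) ∧ ⨆ γ, (S γ).toSubmodule = N.toSubmodule

end CyclicTensor

end

/-! Both group actions are generated by one operator, so everything is written with matrices: an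
equivariant map is a matrix intertwining two operators, and the tensor product has an integral
operator `K` that is used over `ℚ` and over `𝔽_p` at once. Write `J_j` for the Jordan block of size
`j`.

The difficulty is that an equivariant map over `𝔽_p` need not lift to an integral equivariant one.
Two facts get around it. Between sums of Jordan blocks every equivariant map lifts entry by entry
(`mul_liftMatrix`). And modulo `p` the identity of the tensor product is a combination of reductions
of integral endomorphisms through blocks of size less than `p`, plus a trace over `C_p`
(`IsStablyJordan`, `isStablyJordan_tensorMatrix`).

The second fact is an induction. The property passes to sums and to retracts up to a scalar prime to
`p`. It holds for `J_j` with `j < p` trivially and for `J_p` because its identity is a trace. For `1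
≤ j < p` an integral Clebsch–Gordan map from `J_{j+1} ⊕ J_{j-1}` to `J_j ⊗ J_2` is invertible modulo
`p`. This handles tensoring with `J_2`, and it makes `J_{j+1}` a retract of `J_j ⊗ J_2`, so
tensoring with every `J_j`, `1 ≤ j ≤ p`, is reached.

Now let `f` and `g` be the inclusion and projection over `𝔽_p` for the blocks of size less than `p`.
Inserting the identity of the tensor product yields integral equivariant `P` and `Q` that reduce to
`f` and `g` modulo traces. Then `Q * P` reduces to `1` minus a trace, and traces are radical where
no block has size `p`; hence `det (Q * P)` is prime to `p` (`IsStablyJordan.exists_split_lift`). So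
the same `P` is split over `ℚ` and over `𝔽_p`. Its ranges are `N` and `W`, and its columns in one
block span matching indecomposable summands. Reduction maps one onto the other because the
denominators divide `det (Q * P)` (`reduction_eq`). -/

open scoped Kronecker

noncomputable section

namespace CyclicTensor

/-! ### Integer matrices modulo `p`. -/

/-- Reduction modulo `p` of an integer matrix. -/
def red (p : ℕ) {I J : Type*} (A : Matrix I J ℤ) : Matrix I J (ZMod p) :=
  A.map (Int.castRingHom (ZMod p))

section red
variable {p : ℕ} {I J L : Type*}

@[simp] theorem red_apply (A : Matrix I J ℤ) (i : I) (j : J) : red p A i j = (A i j : ZMod p) := rfl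

theorem red_mul [Fintype J] (A : Matrix I J ℤ) (B : Matrix J L ℤ) :
    red p (A * B) = red p A * red p B := Matrix.map_mul

theorem red_mul_mul_comm [Fintype I] [Fintype J] {K : Matrix I I ℤ} {M : Matrix J J ℤ}
    {U : Matrix I J ℤ} (hU : K * U = U * M) : red p K * red p U = red p U * red p M := by
  rw [← red_mul, hU, red_mul]

theorem red_one [DecidableEq I] : red p (1 : Matrix I I ℤ) = 1 :=
  Matrix.map_one _ (map_zero _) (map_one _)

theorem red_add (A B : Matrix I J ℤ) : red p (A + B) = red p A + red p B := by
  ext; simp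

theorem red_sub (A B : Matrix I J ℤ) : red p (A - B) = red p A - red p B := by
  ext; simp

theorem red_smul (c : ℤ) (A : Matrix I J ℤ) : red p (c • A) = (c : ZMod p) • red p A := by
  ext; simp

theorem red_kronecker {I' J' : Type*} (A : Matrix I J ℤ) (B : Matrix I' J' ℤ) :
    red p (A ⊗ₖ B) = red p A ⊗ₖ red p B := by
  ext; simp

theorem map_castRingHom_sigmaMatrix (R : Type*) [CommRing R] (n : ℕ) :
    (sigmaMatrix ℤ n).map (Int.castRingHom R) = sigmaMatrix R n := by
  ext i j
  simp only [Matrix.map_apply, sigmaMatrix, Matrix.of_apply]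
  split_ifs <;> simp

theorem red_sigmaMatrix (n : ℕ) : red p (sigmaMatrix ℤ n) = sigmaMatrix (ZMod p) n :=
  map_castRingHom_sigmaMatrix (ZMod p) n

end red

/-! ### Traces over the cyclic group. -/

section cycTrace
variable {F : Type*} [CommRing F] {I J L : Type*} [Fintype I] [DecidableEq I] [Fintype J]
  [DecidableEq J] [Fintype L] [DecidableEq L]

/-- The sum `∑ K^g h L^(p-1-g)` over `0 ≤ g < p`; up to an automorphism of the source this is the
trace of `h` over the cyclic group of order `p`. -/
def cycTrace (p : ℕ) (K : Matrix I I F) (L : Matrix J J F) (h : Matrix I J F) : Matrix I J F :=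
  ∑ g ∈ Finset.range p, K ^ g * h * L ^ (p - 1 - g)

theorem pow_mul_of_mul_eq {K : Matrix I I F} {M : Matrix J J F} {U : Matrix I J F}
    (h : K * U = U * M) (g : ℕ) : K ^ g * U = U * M ^ g := by
  induction g with
  | zero => simp
  | succ g ih => rw [pow_succ, Matrix.mul_assoc, h, ← Matrix.mul_assoc, ih, Matrix.mul_assoc,
      ← pow_succ]

/-- Together with `cycTrace_mul`: traces form a two-sided ideal among equivariant maps. -/
theorem mul_cycTrace (p : ℕ) {K : Matrix I I F} {M : Matrix J J F} (N : Matrix L L F)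
    {U : Matrix I J F} (hU : K * U = U * M) (h : Matrix J L F) :
    U * cycTrace p M N h = cycTrace p K N (U * h) := by
  simp only [cycTrace, Matrix.mul_sum]
  refine Finset.sum_congr rfl fun g _ => ?_
  rw [← Matrix.mul_assoc (K ^ g), pow_mul_of_mul_eq hU]
  simp only [Matrix.mul_assoc]

theorem cycTrace_mul (p : ℕ) (K : Matrix I I F) {M : Matrix J J F} {N : Matrix L L F}
    {U : Matrix J L F} (hU : M * U = U * N) (h : Matrix I J F) :
    cycTrace p K M h * U = cycTrace p K N (h * U) := by
  simp only [cycTrace, Matrix.sum_mul]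
  refine Finset.sum_congr rfl fun g _ => ?_
  rw [Matrix.mul_assoc, pow_mul_of_mul_eq hU]
  simp only [Matrix.mul_assoc]

theorem cycTrace_add (p : ℕ) (K : Matrix I I F) (M : Matrix J J F) (h h' : Matrix I J F) :
    cycTrace p K M (h + h') = cycTrace p K M h + cycTrace p K M h' := by
  simp only [cycTrace, Matrix.mul_add, Matrix.add_mul, Finset.sum_add_distrib]

theorem cycTrace_smul (p : ℕ) (K : Matrix I I F) (M : Matrix J J F) (c : F) (h : Matrix I J F) :
    cycTrace p K M (c • h) = c • cycTrace p K M h := by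
  simp only [cycTrace, Matrix.mul_smul, Matrix.smul_mul, Finset.smul_sum]

theorem cycTrace_zero (p : ℕ) (K : Matrix I I F) (M : Matrix J J F) :
    cycTrace p K M 0 = 0 := by
  simp [cycTrace]

end cycTrace

/-- In characteristic `p`, the sums `∑ y^g z^(p-1-g)` are invariant under `(y,z) ↦ (y+1,z+1)`. -/
theorem sum_pow_mul_pow_add_one (p : ℕ) [Fact p.Prime] {A : Type*} [Ring A] [Algebra (ZMod p) A]
    {y z : A} (h : Commute y z) :
    ∑ g ∈ Finset.range p, (y + 1) ^ g * (z + 1) ^ (p - 1 - g) =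
      ∑ g ∈ Finset.range p, y ^ g * z ^ (p - 1 - g) := by
  let f : Polynomial (Polynomial (ZMod p)) →+* A :=
    Polynomial.eval₂RingHom' (Polynomial.aeval y).toRingHom z fun a => by
      induction a using Polynomial.induction_on' with
      | add a b ha hb => rw [map_add]; exact ha.add_left hb
      | monomial n a =>
        simp only [AlgHom.toRingHom_eq_coe, RingHom.coe_coe, Polynomial.aeval_monomial]
        exact (Algebra.commute_algebraMap_left a z).mul_left (h.pow_left n)
  have hX : f Polynomial.X = z := by simp [f]
  have hC : f (Polynomial.C Polynomial.X) = y := by simp [f]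
  -- In the domain `𝔽_p[Y][Z]` both sides become `Y^p - Z^p` after multiplication by `Y - Z`, by
  -- Frobenius.
  have key : ∑ g ∈ Finset.range p,
        (Polynomial.C Polynomial.X + 1 : Polynomial (Polynomial (ZMod p))) ^ g
          * (Polynomial.X + 1) ^ (p - 1 - g) =
      ∑ g ∈ Finset.range p, (Polynomial.C Polynomial.X) ^ g * Polynomial.X ^ (p - 1 - g) := by
    have hne : (Polynomial.C Polynomial.X - Polynomial.X : Polynomial (Polynomial (ZMod p))) ≠ 0 := by
      intro h0
      have := congrArg (fun q => Polynomial.coeff q 1) h0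
      simp at this
    apply mul_right_cancel₀ hne
    rw [geom_sum₂_mul]
    have h1 := geom_sum₂_mul (Polynomial.C Polynomial.X + 1 : Polynomial (Polynomial (ZMod p)))
      (Polynomial.X + 1) p
    rw [add_sub_add_right_eq_sub] at h1
    rw [h1, add_pow_char, add_pow_char]
    ring
  simpa [hX, hC] using congrArg f key

/-- Left and right multiplication by `X` commute, so the polynomial identity applies to them. Traces
are thereby expressed in the nilpotent part `X = σ - 1`. -/
theorem cycTrace_one_add (p : ℕ) [Fact p.Prime] {I : Type*} [Fintype I] [DecidableEq I]
    (X h : Matrix I I (ZMod p)) :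
    cycTrace p (1 + X) (1 + X) h = cycTrace p X X h := by
  have hc : Commute (LinearMap.mulLeft (ZMod p) X) (LinearMap.mulRight (ZMod p) X) :=
    LinearMap.commute_mulLeft_right _ _
  have h1 := congrArg (fun f => f h) (sum_pow_mul_pow_add_one p hc)
  have hl : LinearMap.mulLeft (ZMod p) X + 1 = LinearMap.mulLeft (ZMod p) (1 + X) := by
    ext1 m; simp [add_mul, add_comm]
  have hr : LinearMap.mulRight (ZMod p) X + 1 = LinearMap.mulRight (ZMod p) (1 + X) := by
    ext1 m; simp [mul_add, add_comm]
  rw [hl, hr] at h1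
  simpa [cycTrace, ← mul_assoc, LinearMap.pow_mulLeft, LinearMap.pow_mulRight] using h1

/-! ### The identity modulo traces and small Jordan blocks. -/

section stableIdeal

variable {p : ℕ} {I J : Type*} [Fintype I] [DecidableEq I] [Fintype J] [DecidableEq J]

/-- Matrices over `𝔽_p` that are sums of reductions of integral equivariant endomorphisms of `K`
factoring through Jordan blocks of size less than `p`, and of traces. -/
def stableIdeal (p : ℕ) (K : Matrix I I ℤ) : Submodule (ZMod p) (Matrix I I (ZMod p)) :=
  Submodule.span (ZMod p)
    ({B | ∃ j < p, ∃ (b : Matrix I (Fin j) ℤ) (a : Matrix (Fin j) I ℤ),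
        K * b = b * sigmaMatrix ℤ j ∧ a * K = sigmaMatrix ℤ j * a ∧ B = red p b * red p a} ∪
      Set.range (cycTrace p (red p K) (red p K)))

/-- The integer matrix `K` behaves, modulo `p` and modulo traces, as a sum of Jordan blocks of
size less than `p`. -/
def IsStablyJordan (p : ℕ) (K : Matrix I I ℤ) : Prop := 1 ∈ stableIdeal p K

theorem mul_mul_mem_stableIdeal {K : Matrix I I ℤ} {M : Matrix J J ℤ} {U : Matrix I J ℤ}
    {V : Matrix J I ℤ} (hU : K * U = U * M) (hV : M * V = V * K) {B : Matrix J J (ZMod p)}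
    (hB : B ∈ stableIdeal p M) : red p U * B * red p V ∈ stableIdeal p K := by
  induction hB using Submodule.span_induction with
  | mem B hB =>
    apply Submodule.subset_span
    rcases hB with ⟨j, hj, b, a, hb, ha, rfl⟩ | ⟨h, rfl⟩
    · left
      refine ⟨j, hj, U * b, a * V, ?_, ?_, ?_⟩
      · rw [← Matrix.mul_assoc, hU, Matrix.mul_assoc, hb, Matrix.mul_assoc]
      · rw [Matrix.mul_assoc, ← hV, ← Matrix.mul_assoc, ha, Matrix.mul_assoc]
      · simp only [red_mul, Matrix.mul_assoc]
    · right
      exact ⟨red p U * h * red p V, by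
        rw [mul_cycTrace p _ (red_mul_mul_comm hU), cycTrace_mul p _ (red_mul_mul_comm hV)]⟩
  | zero => simp
  | add A B _ _ hA hB => rw [Matrix.mul_add, Matrix.add_mul]; exact add_mem hA hB
  | smul c A _ hA => rw [Matrix.mul_smul, Matrix.smul_mul]; exact Submodule.smul_mem _ _ hA

theorem IsStablyJordan.mul_mem {K : Matrix I I ℤ} {M : Matrix J J ℤ} {U : Matrix I J ℤ}
    {V : Matrix J I ℤ} (hM : IsStablyJordan p M) (hU : K * U = U * M) (hV : M * V = V * K) :
    red p U * red p V ∈ stableIdeal p K := by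
  simpa using mul_mul_mem_stableIdeal hU hV hM

/-- The scalar `c` is allowed because integral splittings are found only up to a determinant prime
to `p`. -/
theorem IsStablyJordan.of_retract {K : Matrix I I ℤ} {M : Matrix J J ℤ} {U : Matrix I J ℤ}
    {V : Matrix J I ℤ} (hM : IsStablyJordan p M) (hU : K * U = U * M) (hV : M * V = V * K)
    {c : ZMod p} [Fact p.Prime] (hc : c ≠ 0) (h : red p U * red p V = c • 1) :
    IsStablyJordan p K := by
  have := Submodule.smul_mem _ c⁻¹ (hM.mul_mem hU hV)
  rwa [h, smul_smul, inv_mul_cancel₀ hc, one_smul] at this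

theorem IsStablyJordan.submatrix {K : Matrix I I ℤ} [Fact p.Prime] (hK : IsStablyJordan p K)
    (e : J ≃ I) : IsStablyJordan p (K.submatrix e e) := by
  have h1 : (1 : Matrix I I ℤ).submatrix e id * (1 : Matrix I I ℤ).submatrix id e = 1 := by
    ext i j
    simp [Matrix.mul_apply, Matrix.one_apply]
  refine hK.of_retract (U := (1 : Matrix I I ℤ).submatrix e id)
    (V := (1 : Matrix I I ℤ).submatrix id e) (c := 1) ?_ ?_ one_ne_zero ?_
  · rw [Matrix.submatrix_mul_equiv K 1 e e id]
    ext i j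
    simp [Matrix.mul_apply, Matrix.one_apply]
  · rw [Matrix.submatrix_mul_equiv 1 K id e e]
    ext i j
    simp [Matrix.mul_apply, Matrix.one_apply]
  · rw [← red_mul, h1, red_one, one_smul]

theorem isStablyJordan_sigmaMatrix_of_lt {j : ℕ} (hj : j < p) :
    IsStablyJordan p (sigmaMatrix ℤ j) :=
  Submodule.subset_span <| Or.inl ⟨j, hj, 1, 1, by simp, by simp, by simp [red_one]⟩

theorem sigmaMatrix_sub_one_apply (B : Type*) [CommRing B] (n : ℕ) (i j : Fin n) :
    (sigmaMatrix B n - 1) i j = if (i : ℕ) = j + 1 then 1 else 0 := by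
  simp only [sigmaMatrix, Matrix.sub_apply, Matrix.of_apply, Matrix.one_apply]
  by_cases h : i = j
  · subst h; simp
  · simp [h]

theorem sigmaMatrix_sub_one_pow_eq (B : Type*) [CommRing B] (n k : ℕ) (i j : Fin n) :
    ((sigmaMatrix B n - 1) ^ k) i j = if (i : ℕ) = j + k then 1 else 0 := by
  induction k generalizing i with
  | zero => simp [Matrix.one_apply, Fin.ext_iff]
  | succ k ih =>
    rw [pow_succ', Matrix.mul_apply]
    simp only [ih, sigmaMatrix_sub_one_apply, ite_mul, one_mul, zero_mul]
    by_cases h : (i : ℕ) = j + (k + 1)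
    · have hlt : (j : ℕ) + k < n := by have := i.2; omega
      rw [Finset.sum_eq_single ⟨j + k, hlt⟩]
      · simp [h, add_assoc]
      · intro b _ hb
        have : (b : ℕ) ≠ j + k := fun h' => hb (Fin.ext h')
        simp [this]
      · simp
    · rw [if_neg h]
      refine Finset.sum_eq_zero fun b _ => ?_
      split_ifs <;> first | rfl | omega

theorem isStablyJordan_sigmaMatrix_self [Fact p.Prime] : IsStablyJordan p (sigmaMatrix ℤ p) := by
  have hp : 0 < p := (Fact.out : p.Prime).pos
  apply Submodule.subset_span
  right
  -- The module is free. With `X = σ - 1` one has `X^g E_{0,p-1} X^{p-1-g} = E_{g,g}`, and these sum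
  -- to the identity.
  refine ⟨(Matrix.single ⟨0, hp⟩ ⟨p - 1, by omega⟩ 1 : Matrix (Fin p) (Fin p) (ZMod p)), ?_⟩
  have h : red p (sigmaMatrix ℤ p) = 1 + (sigmaMatrix (ZMod p) p - 1) := by
    rw [red_sigmaMatrix]; abel
  rw [h, cycTrace_one_add, cycTrace]
  ext i j
  have hs : ∀ A B : Matrix (Fin p) (Fin p) (ZMod p), ∀ a b : Fin p,
      (A * (Matrix.single a b 1 : Matrix (Fin p) (Fin p) (ZMod p)) * B) i j = A i a * B b j := by
    intro A B a b
    rw [Matrix.mul_apply, Finset.sum_eq_single b]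
    · simp
    · intro c _ hc
      rw [Matrix.mul_single_apply_of_ne _ _ _ _ _ hc, zero_mul]
    · simp
  simp only [Matrix.sum_apply, hs, sigmaMatrix_sub_one_pow_eq]
  rw [Finset.sum_eq_single (i : ℕ)]
  · have hi := i.2
    simp only [zero_add, if_true, one_mul, Matrix.one_apply, Fin.ext_iff]
    exact if_congr (by omega) rfl rfl
  · intro g _ hg
    rw [if_neg (by omega), zero_mul]
  · intro h
    exact absurd (Finset.mem_range.2 i.2) h

theorem isStablyJordan_sigmaMatrix [Fact p.Prime] {j : ℕ} (hj : j ≤ p) :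
    IsStablyJordan p (sigmaMatrix ℤ j) := by
  rcases hj.lt_or_eq with h | rfl
  · exact isStablyJordan_sigmaMatrix_of_lt h
  · exact isStablyJordan_sigmaMatrix_self

theorem sigmaMatrix_pow_prime [Fact p.Prime] {n : ℕ} (hn : n ≤ p) :
    sigmaMatrix (ZMod p) n ^ p = 1 :=
  congrArg Units.val (sigma_pow_eq_one p hn)

theorem kronecker_pow {F : Type*} [CommRing F] (A : Matrix I I F) (B : Matrix J J F) (g : ℕ) :
    (A ⊗ₖ B) ^ g = (A ^ g) ⊗ₖ (B ^ g) := by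
  induction g with
  | zero => simp
  | succ g ih => rw [pow_succ, ih, ← Matrix.mul_kronecker_mul, ← pow_succ, ← pow_succ]

/-- The extra `M` in `h ⊗ₖ M` raises the total exponent of `M` in each term from `p - 1` to `p`. -/
theorem cycTrace_kronecker_one (K h : Matrix I I (ZMod p)) {M : Matrix J J (ZMod p)}
    (hM : M ^ p = 1) :
    cycTrace p K K h ⊗ₖ (1 : Matrix J J (ZMod p)) = cycTrace p (K ⊗ₖ M) (K ⊗ₖ M) (h ⊗ₖ M) := by
  have : ∀ g ∈ Finset.range p, (K ⊗ₖ M) ^ g * (h ⊗ₖ M) * (K ⊗ₖ M) ^ (p - 1 - g) =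
      (K ^ g * h * K ^ (p - 1 - g)) ⊗ₖ 1 := by
    intro g hg
    rw [kronecker_pow, kronecker_pow, ← Matrix.mul_kronecker_mul, ← Matrix.mul_kronecker_mul,
      ← pow_succ, ← pow_add]
    have : g + 1 + (p - 1 - g) = p := by have := Finset.mem_range.1 hg; omega
    rw [this, hM]
  rw [cycTrace, cycTrace, Finset.sum_congr rfl this]
  ext ⟨i, i'⟩ ⟨j, j'⟩
  simp [Matrix.sum_apply, Finset.sum_mul]

/-- Tensor an expression of the identity for `K` with the identity of `M`: maps through `J_j` become
maps through `J_j ⊗ M`, to which `hb` applies, and traces remain traces. -/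
theorem IsStablyJordan.kronecker_of_blocks [Fact p.Prime] {K : Matrix I I ℤ} {M : Matrix J J ℤ}
    (hK : IsStablyJordan p K) (hM : red p M ^ p = 1)
    (hb : ∀ j < p, IsStablyJordan p (sigmaMatrix ℤ j ⊗ₖ M)) : IsStablyJordan p (K ⊗ₖ M) := by
  have : ∀ B ∈ stableIdeal p K, B ⊗ₖ (1 : Matrix J J (ZMod p)) ∈ stableIdeal p (K ⊗ₖ M) := by
    intro B hB
    induction hB using Submodule.span_induction with
    | mem B hB =>
      rcases hB with ⟨j, hj, b, a, hb', ha, rfl⟩ | ⟨h, rfl⟩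
      · have := (hb j hj).mul_mem (K := K ⊗ₖ M) (U := b ⊗ₖ 1) (V := a ⊗ₖ 1)
          (by simp only [← Matrix.mul_kronecker_mul, hb', Matrix.mul_one, Matrix.one_mul])
          (by simp only [← Matrix.mul_kronecker_mul, ha, Matrix.mul_one, Matrix.one_mul])
        rwa [red_kronecker, red_kronecker, red_one, ← Matrix.mul_kronecker_mul,
          Matrix.mul_one] at this
      · apply Submodule.subset_span
        right
        rw [cycTrace_kronecker_one _ _ hM, red_kronecker]
        exact ⟨_, rfl⟩
    | zero => simp
    | add A B _ _ hA hB => rw [Matrix.add_kronecker]; exact add_mem hA hB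
    | smul c A _ hA => rw [Matrix.smul_kronecker]; exact Submodule.smul_mem _ _ hA
  simpa [IsStablyJordan] using this 1 hK

end stableIdeal

/-! ### Integral Clebsch–Gordan maps. -/

section cyclic

/-- A family of vectors on which `K - 1` acts as a shift defines an equivariant map from a Jordan
block. -/
theorem mul_of_shift {R : Type*} [CommRing R] {I : Type*} [Fintype I] [DecidableEq I]
    {K : Matrix I I R} {c : ℕ → I → R} {m : ℕ} (hc : ∀ i, K.mulVec (c i) = c i + c (i + 1))
    (hm : c m = 0) :
    K * (Matrix.of fun x (i : Fin m) => c i x) =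
      (Matrix.of fun x (i : Fin m) => c i x) * sigmaMatrix R m := by
  ext x i
  have h1 : (K * (Matrix.of fun x (i : Fin m) => c i x)) x i = c i x + c (i + 1) x :=
    congrFun (hc i) x
  rw [h1, ← add_sub_cancel 1 (sigmaMatrix R m), Matrix.mul_add, Matrix.mul_one, Matrix.add_apply,
    Matrix.mul_apply]
  simp only [Matrix.of_apply, sigmaMatrix_sub_one_apply, mul_ite, mul_one, mul_zero]
  congr 1
  by_cases h : (i : ℕ) + 1 < m
  · rw [Finset.sum_eq_single ⟨i + 1, h⟩]
    · simp
    · intro b _ hb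
      rw [if_neg fun h' => hb (Fin.ext h')]
    · simp
  · have him : (i : ℕ) + 1 = m := by have := i.2; omega
    rw [him, hm]
    refine (Finset.sum_eq_zero fun b _ => ?_).symm
    rw [if_neg (by have := b.2; omega)]

/-- The standard basis vector `x^a ⊗ e_b` of the tensor product of Jordan blocks of sizes `j`
and `2`, which is zero for `j ≤ a`. -/
def stdVec (R : Type*) [CommRing R] (j : ℕ) (b : Fin 2) (a : ℕ) : Fin j × Fin 2 → R :=
  fun x => if (x.1 : ℕ) = a ∧ x.2 = b then 1 else 0

variable (R : Type*) [CommRing R] (j : ℕ)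

theorem stdVec_of_le {b : Fin 2} {a : ℕ} (h : j ≤ a) : stdVec R j b a = 0 := by
  ext x
  simp only [stdVec, Pi.zero_apply]
  rw [if_neg]
  rintro ⟨h1, -⟩
  have := x.1.2
  omega

theorem mulVec_stdVec (K : Matrix (Fin j × Fin 2) (Fin j × Fin 2) R) (b : Fin 2) {a : ℕ}
    (h : a < j) : K.mulVec (stdVec R j b a) = fun x => K x (⟨a, h⟩, b) := by
  have : stdVec R j b a = Pi.single (⟨a, h⟩, b) 1 := by
    ext x
    simp [stdVec, Pi.single_apply, Prod.ext_iff, Fin.ext_iff]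
  rw [this, Matrix.mulVec_single_one]
  rfl

theorem mulVec_stdVec_zero (a : ℕ) :
    (sigmaMatrix R j ⊗ₖ sigmaMatrix R 2).mulVec (stdVec R j 0 a) =
      stdVec R j 0 a + stdVec R j 0 (a + 1) + stdVec R j 1 a + stdVec R j 1 (a + 1) := by
  rcases lt_or_ge a j with h | h
  · rw [mulVec_stdVec R j _ _ h]
    ext ⟨x, y⟩
    simp only [Matrix.kronecker_apply, sigmaMatrix, Matrix.of_apply, stdVec, Pi.add_apply,
      Fin.ext_iff]
    fin_cases y <;> by_cases h1 : (x : ℕ) = a <;> by_cases h2 : (x : ℕ) = a + 1 <;>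
      simp [h1, h2]
  · simp [stdVec_of_le R j h, stdVec_of_le R j (h.trans (Nat.le_succ a))]

theorem mulVec_stdVec_one (a : ℕ) :
    (sigmaMatrix R j ⊗ₖ sigmaMatrix R 2).mulVec (stdVec R j 1 a) =
      stdVec R j 1 a + stdVec R j 1 (a + 1) := by
  rcases lt_or_ge a j with h | h
  · rw [mulVec_stdVec R j _ _ h]
    ext ⟨x, y⟩
    simp only [Matrix.kronecker_apply, sigmaMatrix, Matrix.of_apply, stdVec, Pi.add_apply,
      Fin.ext_iff]
    fin_cases y <;> by_cases h1 : (x : ℕ) = a <;> by_cases h2 : (x : ℕ) = a + 1 <;>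
      simp [h1, h2]
  · simp [stdVec_of_le R j h, stdVec_of_le R j (h.trans (Nat.le_succ a))]

/-- The orbit of a generator of the summand of rank `j + 1` under the powers of `σ - 1`. -/
def topVec (i : ℕ) : Fin j × Fin 2 → R :=
  stdVec R j 0 i + (i : R) • (stdVec R j 1 (i - 1) + stdVec R j 1 i)

/-- The orbit of a generator of the summand of rank `j - 1` under the powers of `σ - 1`. -/
def subVec (i : ℕ) : Fin j × Fin 2 → R :=
  stdVec R j 0 (i + 1) + (i : R) • stdVec R j 1 (i + 1) +
    ((i : R) + 1 - (j : R)) • stdVec R j 1 i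

/-- Let `X` and `Y` be the nilpotent parts on the two factors. Since `Y² = 0`, the `i`-th power of
`X⊗1 + 1⊗Y + X⊗Y` is `X^i⊗1 + i(X^{i-1} + X^i)⊗Y`; apply it to `1⊗e_0`. At `i = 0` the truncated `i
- 1` has coefficient `0`. -/
theorem mulVec_topVec (i : ℕ) : (sigmaMatrix R j ⊗ₖ sigmaMatrix R 2).mulVec (topVec R j i) =
    topVec R j i + topVec R j (i + 1) := by
  simp only [topVec, Matrix.mulVec_add, Matrix.mulVec_smul, mulVec_stdVec_zero, mulVec_stdVec_one]
  rcases i with _ | i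
  · simp
    abel
  · simp only [Nat.add_sub_cancel]
    push_cast
    module

theorem mulVec_subVec (i : ℕ) : (sigmaMatrix R j ⊗ₖ sigmaMatrix R 2).mulVec (subVec R j i) =
    subVec R j i + subVec R j (i + 1) := by
  simp only [subVec, Matrix.mulVec_add, Matrix.mulVec_smul, mulVec_stdVec_zero, mulVec_stdVec_one]
  push_cast
  module

theorem topVec_eq_zero : topVec R j (j + 1) = 0 := by
  simp [topVec, stdVec_of_le]

/-- The starting vector `x⊗e_0 + (1-j)·(1⊗e_1)` is chosen so that the coefficient `i + 1 - j`
vanishes exactly when `x^{i+1}` does, at `i = j - 1`. -/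
theorem subVec_eq_zero (hj : 1 ≤ j) : subVec R j (j - 1) = 0 := by
  obtain ⟨m, rfl⟩ : ∃ m, j = m + 1 := ⟨j - 1, by omega⟩
  simp [subVec, stdVec_of_le]

/-- The Clebsch–Gordan map from the sum of Jordan blocks of sizes `j + 1` and `j - 1` to the
product of Jordan blocks of sizes `j` and `2`. -/
def clebschGordan : Matrix (Fin j × Fin 2) (Fin (j + 1) ⊕ Fin (j - 1)) R :=
  Matrix.fromCols (Matrix.of fun x i => topVec R j i x) (Matrix.of fun x i => subVec R j i x)

theorem kronecker_mul_clebschGordan (hj : 1 ≤ j) :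
    (sigmaMatrix R j ⊗ₖ sigmaMatrix R 2) * clebschGordan R j =
      clebschGordan R j *
        Matrix.fromBlocks (sigmaMatrix R (j + 1)) 0 0 (sigmaMatrix R (j - 1)) := by
  rw [clebschGordan, Matrix.fromCols_mul_fromBlocks, Matrix.mul_fromCols,
    mul_of_shift (mulVec_topVec R j) (topVec_eq_zero R j),
    mul_of_shift (mulVec_subVec R j) (subVec_eq_zero R j hj)]
  simp

theorem red_clebschGordan (p : ℕ) : red p (clebschGordan ℤ j) = clebschGordan (ZMod p) j := by
  ext x (i | i) <;>
  simp only [red_apply, clebschGordan, Matrix.fromCols_apply_inl, Matrix.fromCols_apply_inr,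
    Matrix.of_apply, topVec, subVec, stdVec, Pi.add_apply, Pi.smul_apply, smul_eq_mul] <;>
  push_cast <;> rfl

/-- One has `topVec (i+1) - subVec i = j·(x^i⊗e_1) + x^{i+1}⊗e_1`. As `j` is invertible, descending
induction on `i` gives all `x^i⊗e_1`, and then `topVec` gives all `x^i⊗e_0`. -/
theorem clebschGordan_surjective {F : Type*} [Field F] (hj : 1 ≤ j) (hF : (j : F) ≠ 0) :
    Function.Surjective (clebschGordan F j).mulVec := by
  let U := LinearMap.range (clebschGordan F j).mulVecLin
  have htop : ∀ i ≤ j, topVec F j i ∈ U := by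
    intro i hi
    refine ⟨Pi.single (Sum.inl ⟨i, by omega⟩) 1, ?_⟩
    rw [Matrix.mulVecLin_apply, Matrix.mulVec_single_one]
    rfl
  have hsub : ∀ i < j - 1, subVec F j i ∈ U := by
    intro i hi
    refine ⟨Pi.single (Sum.inr ⟨i, hi⟩) 1, ?_⟩
    rw [Matrix.mulVecLin_apply, Matrix.mulVec_single_one]
    rfl
  have h1 : ∀ d i, i + d = j → stdVec F j 1 i ∈ U := by
    intro d
    induction d with
    | zero =>
      intro i hi
      rw [stdVec_of_le F j (by omega)]
      exact zero_mem U
    | succ d ih =>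
      intro i hi
      have h2 : (j : F) • stdVec F j 1 i ∈ U := by
        rcases d with _ | d
        -- For `i = j - 1` there is no column `subVec i`, but `topVec j` is already
        -- `j·(x^{j-1}⊗e_1)`.
        · have h3 := htop j le_rfl
          rw [topVec, stdVec_of_le F j le_rfl, stdVec_of_le F j le_rfl, zero_add, add_zero] at h3
          rwa [show i = j - 1 by omega]
        · have h3 := U.sub_mem (U.sub_mem (htop (i + 1) (by omega)) (hsub i (by omega)))
            (ih (i + 1) (by omega))
          convert h3 using 1
          simp only [topVec, subVec, Nat.add_sub_cancel]
          push_cast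
          module
      have h3 := U.smul_mem (j : F)⁻¹ h2
      rwa [smul_smul, inv_mul_cancel₀ hF, one_smul] at h3
  have h1' : ∀ i, stdVec F j 1 i ∈ U := by
    intro i
    rcases le_total i j with h | h
    · exact h1 (j - i) i (by omega)
    · rw [stdVec_of_le F j h]
      exact zero_mem U
  have h0 : ∀ i ≤ j, stdVec F j 0 i ∈ U := by
    intro i hi
    have h3 := U.sub_mem (htop i hi) (U.smul_mem (i : F) (U.add_mem (h1' (i - 1)) (h1' i)))
    rwa [topVec, add_sub_cancel_right] at h3
  have hU : U = ⊤ := by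
    rw [eq_top_iff, ← (Pi.basisFun F (Fin j × Fin 2)).span_eq, Submodule.span_le]
    rintro _ ⟨⟨a, b⟩, rfl⟩
    have h4 : Pi.basisFun F (Fin j × Fin 2) (a, b) = stdVec F j b a := by
      ext x
      simp [stdVec, Pi.single_apply, Prod.ext_iff, Fin.ext_iff]
    rw [h4]
    fin_cases b
    · exact h0 a a.2.le
    · exact h1' a
  intro v
  have hv : v ∈ U := hU ▸ Submodule.mem_top
  exact hv

end cyclic

/-- An integral equivariant map that is invertible modulo `p` has an equivariant inverse up to a
scalar prime to `p`. -/
theorem exists_inverse_up_to_scalar {p : ℕ} [Fact p.Prime] {I J : Type*} [Fintype I]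
    [DecidableEq I] [Fintype J] [DecidableEq J] {K : Matrix I I ℤ} {S : Matrix J J ℤ}
    {P : Matrix I J ℤ} (e : I ≃ J) (hP : K * P = P * S)
    (hs : Function.Surjective (red p P).mulVec) :
    ∃ (Q : Matrix J I ℤ) (d : ℤ), (d : ZMod p) ≠ 0 ∧ S * Q = Q * K ∧ P * Q = d • 1 ∧
      Q * P = d • 1 := by
  -- Reindexing makes `P` square; the inverse up to scalar is its adjugate, with scalar `T.det`.
  let T : Matrix I I ℤ := P.submatrix id e
  have hPT : P = T.submatrix id e.symm := by simp [T]
  have hd : (T.det : ZMod p) ≠ 0 := by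
    have h1 : (T.det : ZMod p) = (red p T).det := Int.cast_det T
    rw [h1, ← isUnit_iff_ne_zero, ← Matrix.isUnit_iff_isUnit_det,
      ← Matrix.mulVec_surjective_iff_isUnit]
    intro v
    obtain ⟨w, hw⟩ := hs v
    refine ⟨w ∘ e, ?_⟩
    rw [← hw]
    ext i
    simp only [Matrix.mulVec, dotProduct, red_apply, T, Matrix.submatrix_apply, id,
      Function.comp_apply]
    exact e.sum_comp fun j => (P i j : ZMod p) * w j
  have hd0 : T.det ≠ 0 := by
    rintro h
    simp [h] at hd
  have hPQ : P * T.adjugate.submatrix e.symm id = T.det • 1 := by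
    rw [hPT, Matrix.submatrix_mul_equiv T _ id e.symm id, Matrix.mul_adjugate]
    rfl
  have hQP : T.adjugate.submatrix e.symm id * P = T.det • 1 := by
    rw [hPT, ← Matrix.submatrix_mul _ _ e.symm id e.symm Function.bijective_id,
      Matrix.adjugate_mul]
    ext a b
    simp only [Matrix.submatrix_apply, Matrix.smul_apply, Matrix.one_apply,
      e.symm.injective.eq_iff]
  refine ⟨T.adjugate.submatrix e.symm id, T.det, hd, ?_, hPQ, hQP⟩
  set Q := T.adjugate.submatrix e.symm id
  -- Equivariance of `Q` holds after multiplication by the nonzero integer `T.det`, which then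
  -- cancels.
  have h1 : T.det • (S * Q) = T.det • (Q * K) := by
    calc T.det • (S * Q) = (T.det • (1 : Matrix J J ℤ)) * (S * Q) := by
          rw [Matrix.smul_mul, Matrix.one_mul]
      _ = Q * (P * S) * Q := by rw [← hQP]; simp only [Matrix.mul_assoc]
      _ = Q * K * (P * Q) := by rw [← hP]; simp only [Matrix.mul_assoc]
      _ = T.det • (Q * K) := by rw [hPQ, Matrix.mul_smul, Matrix.mul_one]
  exact smul_right_injective _ hd0 h1

/-! ### Tensor products of Jordan blocks. -/

section stable

theorem IsStablyJordan.fromBlocks {p : ℕ} {I J : Type*} [Fintype I] [DecidableEq I] [Fintype J]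
    [DecidableEq J] {K : Matrix I I ℤ} {M : Matrix J J ℤ} (hK : IsStablyJordan p K)
    (hM : IsStablyJordan p M) : IsStablyJordan p (Matrix.fromBlocks K 0 0 M) := by
  have h1 := hK.mul_mem (K := Matrix.fromBlocks K 0 0 M) (U := Matrix.fromRows 1 0)
    (V := Matrix.fromCols 1 0) (by simp [Matrix.fromBlocks_mul_fromRows, Matrix.fromRows_mul])
    (by simp [Matrix.fromCols_mul_fromBlocks, Matrix.mul_fromCols])
  have h2 := hM.mul_mem (K := Matrix.fromBlocks K 0 0 M) (U := Matrix.fromRows 0 1)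
    (V := Matrix.fromCols 0 1) (by simp [Matrix.fromBlocks_mul_fromRows, Matrix.fromRows_mul])
    (by simp [Matrix.fromCols_mul_fromBlocks, Matrix.mul_fromCols])
  have h3 := add_mem h1 h2
  have h4 : (Matrix.fromRows 1 0 : Matrix (I ⊕ J) I ℤ) * (Matrix.fromCols 1 0 : Matrix I (I ⊕ J) ℤ) +
      (Matrix.fromRows 0 1 : Matrix (I ⊕ J) J ℤ) * (Matrix.fromCols 0 1 : Matrix J (I ⊕ J) ℤ) = 1 := by
    rw [Matrix.fromRows_mul_fromCols, Matrix.fromRows_mul_fromCols, Matrix.fromBlocks_add,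
      ← Matrix.fromBlocks_one]
    simp only [Matrix.mul_one, Matrix.mul_zero, add_zero, zero_add]
  rwa [← red_mul, ← red_mul, ← red_add, h4, red_one] at h3

variable {p : ℕ} [Fact p.Prime]

theorem exists_clebschGordan_inverse {j : ℕ} (h1 : 1 ≤ j) (hj : j < p) :
    ∃ (Q : Matrix (Fin (j + 1) ⊕ Fin (j - 1)) (Fin j × Fin 2) ℤ) (d : ℤ), (d : ZMod p) ≠ 0 ∧
      Matrix.fromBlocks (sigmaMatrix ℤ (j + 1)) 0 0 (sigmaMatrix ℤ (j - 1)) * Q =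
        Q * (sigmaMatrix ℤ j ⊗ₖ sigmaMatrix ℤ 2) ∧
      clebschGordan ℤ j * Q = d • 1 ∧ Q * clebschGordan ℤ j = d • 1 := by
  refine exists_inverse_up_to_scalar (Fintype.equivOfCardEq ?_)
    (kronecker_mul_clebschGordan ℤ j h1) ?_
  · simp only [Fintype.card_prod, Fintype.card_fin, Fintype.card_sum]
    omega
  · rw [red_clebschGordan]
    apply clebschGordan_surjective j h1
    rw [Ne, ZMod.natCast_eq_zero_iff]
    exact fun h => absurd (Nat.le_of_dvd h1 h) (by omega)

theorem isStablyJordan_sigmaMatrix_kronecker_two {j : ℕ} (hj : j < p) :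
    IsStablyJordan p (sigmaMatrix ℤ j ⊗ₖ sigmaMatrix ℤ 2) := by
  rcases Nat.eq_zero_or_pos j with rfl | h1
  · rw [IsStablyJordan, Subsingleton.elim (1 : Matrix (Fin 0 × Fin 2) _ (ZMod p)) 0]
    exact zero_mem _
  obtain ⟨Q, d, hd, hQ, hPQ, -⟩ := exists_clebschGordan_inverse h1 hj
  refine IsStablyJordan.of_retract
    ((isStablyJordan_sigmaMatrix (j := j + 1) hj).fromBlocks
      (isStablyJordan_sigmaMatrix (j := j - 1) (by omega)))
    (kronecker_mul_clebschGordan ℤ j h1) hQ hd ?_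
  rw [← red_mul, hPQ, red_smul, red_one]

variable {I : Type*} [Fintype I] [DecidableEq I] {K : Matrix I I ℤ}

theorem IsStablyJordan.kronecker_two (hK : IsStablyJordan p K) :
    IsStablyJordan p (K ⊗ₖ sigmaMatrix ℤ 2) :=
  hK.kronecker_of_blocks
    (by rw [red_sigmaMatrix]; exact sigmaMatrix_pow_prime (Fact.out : p.Prime).two_le)
    fun _ hj => isStablyJordan_sigmaMatrix_kronecker_two hj

/-- Up to a scalar prime to `p`, `J_{j+1}` is a retract of `J_j ⊗ J_2` for `1 ≤ j < p`; hence `K ⊗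
J_{j+1}` is one of `(K ⊗ J_j) ⊗ J_2`, and sizes grow one by one up to `p`. -/
theorem IsStablyJordan.kronecker_sigmaMatrix (hK : IsStablyJordan p K) {j : ℕ} (h1 : 1 ≤ j)
    (hj : j ≤ p) : IsStablyJordan p (K ⊗ₖ sigmaMatrix ℤ j) := by
  induction j, h1 using Nat.le_induction with
  | base =>
    have h2 := hK.submatrix (Equiv.prodUnique I (Fin 1))
    convert h2 using 1
    ext ⟨a, b⟩ ⟨c, d⟩
    simp [sigmaMatrix, Subsingleton.elim b d]
  | succ j h1 ih =>
    obtain ⟨Q, d, hd, hQ, -, hQP⟩ := exists_clebschGordan_inverse (p := p) h1 hj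
    have h2 := ((ih (by omega)).kronecker_two).submatrix (Equiv.prodAssoc I (Fin j) (Fin 2)).symm
    have h3 : ((K ⊗ₖ sigmaMatrix ℤ j) ⊗ₖ sigmaMatrix ℤ 2).submatrix
        (Equiv.prodAssoc I (Fin j) (Fin 2)).symm (Equiv.prodAssoc I (Fin j) (Fin 2)).symm =
        K ⊗ₖ (sigmaMatrix ℤ j ⊗ₖ sigmaMatrix ℤ 2) := by
      ext ⟨a, b, c⟩ ⟨a', b', c'⟩
      simp [mul_assoc]
    rw [h3] at h2
    have hP' : (sigmaMatrix ℤ j ⊗ₖ sigmaMatrix ℤ 2) * (clebschGordan ℤ j).toCols₁ =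
        (clebschGordan ℤ j).toCols₁ * sigmaMatrix ℤ (j + 1) :=
      mul_of_shift (mulVec_topVec ℤ j) (topVec_eq_zero ℤ j)
    have hQ' : sigmaMatrix ℤ (j + 1) * Q.toRows₁ =
        Q.toRows₁ * (sigmaMatrix ℤ j ⊗ₖ sigmaMatrix ℤ 2) := by
      rw [← Matrix.fromRows_toRows Q, Matrix.fromBlocks_mul_fromRows, Matrix.fromRows_mul] at hQ
      simpa using (Matrix.fromRows_inj hQ).1
    have hQP' : Q.toRows₁ * (clebschGordan ℤ j).toCols₁ = d • 1 := by
      ext a b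
      have := congrFun (congrFun hQP (Sum.inl a)) (Sum.inl b)
      simp only [Matrix.smul_apply, Matrix.one_apply, Sum.inl.injEq] at this ⊢
      exact this
    refine h2.of_retract (U := (1 : Matrix I I ℤ) ⊗ₖ Q.toRows₁)
      (V := (1 : Matrix I I ℤ) ⊗ₖ (clebschGordan ℤ j).toCols₁) (c := d) ?_ ?_ hd ?_
    · rw [← Matrix.mul_kronecker_mul, ← Matrix.mul_kronecker_mul, hQ', Matrix.mul_one,
        Matrix.one_mul]
    · rw [← Matrix.mul_kronecker_mul, ← Matrix.mul_kronecker_mul, hP', Matrix.mul_one,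
        Matrix.one_mul]
    · rw [← red_mul, ← Matrix.mul_kronecker_mul, hQP', Matrix.one_mul, Matrix.kronecker_smul,
        Matrix.one_kronecker_one, red_smul, red_one]

end stable

/-- The matrix of the tensor product of the Jordan blocks of sizes `n k`. -/
def tensorMatrix (R : Type*) [CommRing R] {r : ℕ} (n : Fin r → ℕ) :
    Matrix (∀ k, Fin (n k)) (∀ k, Fin (n k)) R :=
  Matrix.of fun i j => ∏ k, sigmaMatrix R (n k) (i k) (j k)

theorem isStablyJordan_tensorMatrix {p : ℕ} [Fact p.Prime] {r : ℕ} (n : Fin r → ℕ)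
    (hn : ∀ k, 1 ≤ n k ∧ n k ≤ p) : IsStablyJordan p (tensorMatrix ℤ n) := by
  induction r with
  | zero =>
    have h := (isStablyJordan_sigmaMatrix_of_lt (p := p) (j := 1) (Fact.out : p.Prime).one_lt)
    have h2 := h.submatrix (Equiv.ofUnique (∀ k, Fin (n k)) (Fin 1))
    convert h2 using 1
    ext i j
    simp [tensorMatrix, sigmaMatrix, Subsingleton.elim i j]
  | succ r ih =>
    have h := (ih (fun k => n k.succ) fun k => hn k.succ).kronecker_sigmaMatrix (hn 0).1 (hn 0).2
    have h2 := h.submatrix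
      ((Fin.consEquiv fun k => Fin (n k)).symm.trans (Equiv.prodComm _ _))
    convert h2 using 1
    ext i j
    simp [tensorMatrix, Fin.prod_univ_succ, mul_comm, Fin.tail]

/-! ### Shift matrices and sums of Jordan blocks. -/

/-- Every row and every column of `A - 1` has at most one nonzero entry, and this entry is `1`. -/
def IsShift {I : Type*} [DecidableEq I] (A : Matrix I I ℤ) : Prop :=
  (∀ b, ∃ a, (∀ a' ≠ a, (A - 1) a' b = 0) ∧ ((A - 1) a b = 0 ∨ (A - 1) a b = 1)) ∧
    ∀ a, ∃ b, (∀ b' ≠ b, (A - 1) a b' = 0) ∧ ((A - 1) a b = 0 ∨ (A - 1) a b = 1)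

theorem isShift_sigmaMatrix (n : ℕ) : IsShift (sigmaMatrix ℤ n) := by
  constructor
  · intro b
    by_cases h : (b : ℕ) + 1 < n
    · refine ⟨⟨b + 1, h⟩, fun a ha => ?_, ?_⟩
      · rw [sigmaMatrix_sub_one_apply, if_neg fun h' => ha (Fin.ext h')]
      · rw [sigmaMatrix_sub_one_apply, if_pos rfl]
        exact Or.inr rfl
    · have h0 : ∀ a, (sigmaMatrix ℤ n - 1) a b = 0 := fun a => by
        rw [sigmaMatrix_sub_one_apply, if_neg (by have := a.2; omega)]
      exact ⟨b, fun a _ => h0 a, Or.inl (h0 b)⟩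
  · intro a
    by_cases h : 0 < (a : ℕ)
    · refine ⟨⟨a - 1, by omega⟩, fun b hb => ?_, ?_⟩
      · rw [sigmaMatrix_sub_one_apply, if_neg]
        rintro h'
        exact hb (Fin.ext (by simp only; omega))
      · rw [sigmaMatrix_sub_one_apply, if_pos (by simp only; omega)]
        exact Or.inr rfl
    · have h0 : ∀ b, (sigmaMatrix ℤ n - 1) a b = 0 := fun b => by
        rw [sigmaMatrix_sub_one_apply, if_neg (by omega)]
      exact ⟨a, fun b _ => h0 b, Or.inl (h0 a)⟩

/-- The block diagonal matrix with Jordan blocks of sizes `s x`. -/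
def blockSigma (R : Type*) [CommRing R] {X : Type*} [DecidableEq X] (s : X → ℕ) :
    Matrix (Σ x, Fin (s x)) (Σ x, Fin (s x)) R :=
  Matrix.blockDiagonal' fun x => sigmaMatrix R (s x)

section blockSigma
variable {X : Type*} [DecidableEq X] (s : X → ℕ)

theorem blockSigma_sub_one (R : Type*) [CommRing R] :
    blockSigma R s - 1 = Matrix.blockDiagonal' fun x => sigmaMatrix R (s x) - 1 := by
  rw [blockSigma, ← Matrix.blockDiagonal'_one, ← Matrix.blockDiagonal'_sub]
  rfl

theorem isShift_blockSigma : IsShift (blockSigma ℤ s) := by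
  rw [IsShift, blockSigma_sub_one]
  constructor
  · rintro ⟨x, b⟩
    obtain ⟨a, h1, h2⟩ := (isShift_sigmaMatrix (s x)).1 b
    refine ⟨⟨x, a⟩, ?_, ?_⟩
    · rintro ⟨y, a'⟩ h
      by_cases hxy : y = x
      · subst hxy
        rw [Matrix.blockDiagonal'_apply_eq]
        exact h1 a' fun h' => h (by rw [h'])
      · exact Matrix.blockDiagonal'_apply_ne _ _ _ hxy
    · rwa [Matrix.blockDiagonal'_apply_eq]
  · rintro ⟨x, b⟩
    obtain ⟨a, h1, h2⟩ := (isShift_sigmaMatrix (s x)).2 b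
    refine ⟨⟨x, a⟩, ?_, ?_⟩
    · rintro ⟨y, a'⟩ h
      by_cases hxy : x = y
      · subst hxy
        rw [Matrix.blockDiagonal'_apply_eq]
        exact h1 a' fun h' => h (by rw [h'])
      · exact Matrix.blockDiagonal'_apply_ne _ _ _ hxy
    · rwa [Matrix.blockDiagonal'_apply_eq]

theorem map_castRingHom_blockSigma (R : Type*) [CommRing R] :
    (blockSigma ℤ s).map (Int.castRingHom R) = blockSigma R s := by
  rw [blockSigma, Matrix.blockDiagonal'_map _ _ (map_zero _), blockSigma]
  congr 1
  ext1 x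
  exact map_castRingHom_sigmaMatrix R (s x)

theorem red_blockSigma (p : ℕ) : red p (blockSigma ℤ s) = blockSigma (ZMod p) s :=
  map_castRingHom_blockSigma s (ZMod p)

theorem blockSigma_sub_one_pow (R : Type*) [CommRing R] [Fintype X] {k : ℕ} (hs : ∀ x, s x ≤ k) :
    (blockSigma R s - 1) ^ k = 0 := by
  rw [blockSigma_sub_one, ← Matrix.blockDiagonal'_pow, ← Matrix.blockDiagonal'_zero]
  congr 1
  ext x i j
  exact sigmaMatrix_sub_one_pow_apply _ _ _ i j (by have := i.2; have := hs x; omega)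

end blockSigma

/-! ### Lifting equivariant maps from `𝔽_p` to `ℤ`. -/

section lift
variable {p : ℕ} [Fact p.Prime]

/-- The entrywise smallest nonnegative integral lift of a matrix over `𝔽_p`. -/
def liftMatrix {I J : Type*} (f : Matrix I J (ZMod p)) : Matrix I J ℤ := f.map fun z => (z.val : ℤ)

theorem red_liftMatrix {I J : Type*} (f : Matrix I J (ZMod p)) : red p (liftMatrix f) = f := by
  ext i j
  simp [liftMatrix]

variable {I J : Type*} [Fintype I] [DecidableEq I] [Fintype J] [DecidableEq J]

/-- Multiplication by `K - 1` or `L - 1` only moves entries or replaces them by `0`. No sums of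
entries occur, so it commutes with the entrywise lift. -/
theorem mul_liftMatrix {K : Matrix I I ℤ} {L : Matrix J J ℤ} (hK : IsShift K) (hL : IsShift L)
    {f : Matrix I J (ZMod p)} (hf : red p K * f = f * red p L) :
    K * liftMatrix f = liftMatrix f * L := by
  have h1 : red p (K - 1) * f = f * red p (L - 1) := by
    rw [red_sub, red_sub, red_one, red_one, Matrix.sub_mul, Matrix.mul_sub, hf, Matrix.one_mul,
      Matrix.mul_one]
  have h2 : (K - 1) * liftMatrix f = liftMatrix (red p (K - 1) * f) := by
    ext i j
    obtain ⟨b, hb, hb'⟩ := hK.2 i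
    rw [liftMatrix, liftMatrix, Matrix.map_apply, Matrix.mul_apply, Matrix.mul_apply,
      Finset.sum_eq_single b, Finset.sum_eq_single b]
    · rcases hb' with h | h <;> simp [h, -Matrix.sub_apply]
    · intro c _ hc; simp [hb c hc, -Matrix.sub_apply]
    · simp
    · intro c _ hc; simp [hb c hc, -Matrix.sub_apply]
    · simp
  have h3 : liftMatrix f * (L - 1) = liftMatrix (f * red p (L - 1)) := by
    ext i j
    obtain ⟨b, hb, hb'⟩ := hL.1 j
    rw [liftMatrix, liftMatrix, Matrix.map_apply, Matrix.mul_apply, Matrix.mul_apply,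
      Finset.sum_eq_single b, Finset.sum_eq_single b]
    · rcases hb' with h | h <;> simp [h, -Matrix.sub_apply]
    · intro c _ hc; simp [hb c hc, -Matrix.sub_apply]
    · simp
    · intro c _ hc; simp [hb c hc, -Matrix.sub_apply]
    · simp
  rw [h1, ← h3, Matrix.sub_mul, Matrix.mul_sub, Matrix.one_mul, Matrix.mul_one] at h2
  exact sub_left_injective h2

/-- Multiply by `f` an expression of the identity in the stable ideal. In a term `b a` the factor
`red p a * f` runs between shift matrices, so it lifts; a trace times `f` is a trace.
`exists_lift_from` is the mirror image. -/
theorem IsStablyJordan.exists_lift_into {K : Matrix I I ℤ} {L : Matrix J J ℤ}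
    (hK : IsStablyJordan p K) (hL : IsShift L) {f : Matrix I J (ZMod p)}
    (hf : red p K * f = f * red p L) :
    ∃ (P : Matrix I J ℤ) (h : Matrix I J (ZMod p)), K * P = P * L ∧
      red p P = f - cycTrace p (red p K) (red p L) h := by
  have : ∀ B ∈ stableIdeal p K, ∃ (P : Matrix I J ℤ) (h : Matrix I J (ZMod p)), K * P = P * L ∧
      red p P = B * f - cycTrace p (red p K) (red p L) h := by
    intro B hB
    induction hB using Submodule.span_induction with
    | mem B hB =>
      rcases hB with ⟨j, hj, b, a, hb, ha, rfl⟩ | ⟨h, rfl⟩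
      · have h1 : red p (sigmaMatrix ℤ j) * (red p a * f) = (red p a * f) * red p L := by
          rw [← Matrix.mul_assoc, red_mul_mul_comm ha.symm, Matrix.mul_assoc, hf,
            Matrix.mul_assoc]
        refine ⟨b * liftMatrix (red p a * f), 0, ?_, ?_⟩
        · rw [← Matrix.mul_assoc, hb, Matrix.mul_assoc,
            mul_liftMatrix (isShift_sigmaMatrix j) hL h1, Matrix.mul_assoc]
        · rw [red_mul, red_liftMatrix, cycTrace_zero, sub_zero, Matrix.mul_assoc]
      · refine ⟨0, h * f, by simp, ?_⟩
        rw [cycTrace_mul p _ hf, sub_self]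
        ext; simp
    | zero => exact ⟨0, 0, by simp, by ext; simp [cycTrace_zero]⟩
    | add A B _ _ hA hB =>
      obtain ⟨P, h, h1, h2⟩ := hA
      obtain ⟨P', h', h1', h2'⟩ := hB
      refine ⟨P + P', h + h', by rw [Matrix.mul_add, Matrix.add_mul, h1, h1'], ?_⟩
      rw [red_add, h2, h2', cycTrace_add, Matrix.add_mul]
      abel
    | smul c A _ hA =>
      obtain ⟨P, h, h1, h2⟩ := hA
      refine ⟨(c.val : ℤ) • P, c • h, by rw [Matrix.mul_smul, Matrix.smul_mul, h1], ?_⟩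
      rw [red_smul, h2, cycTrace_smul, Matrix.smul_mul, smul_sub]
      simp
  simpa using this 1 hK

theorem IsStablyJordan.exists_lift_from {K : Matrix I I ℤ} {L : Matrix J J ℤ}
    (hK : IsStablyJordan p K) (hL : IsShift L) {f : Matrix J I (ZMod p)}
    (hf : red p L * f = f * red p K) :
    ∃ (P : Matrix J I ℤ) (h : Matrix J I (ZMod p)), L * P = P * K ∧
      red p P = f - cycTrace p (red p L) (red p K) h := by
  have : ∀ B ∈ stableIdeal p K, ∃ (P : Matrix J I ℤ) (h : Matrix J I (ZMod p)), L * P = P * K ∧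
      red p P = f * B - cycTrace p (red p L) (red p K) h := by
    intro B hB
    induction hB using Submodule.span_induction with
    | mem B hB =>
      rcases hB with ⟨j, hj, b, a, hb, ha, rfl⟩ | ⟨h, rfl⟩
      · have h1 : red p L * (f * red p b) = (f * red p b) * red p (sigmaMatrix ℤ j) := by
          rw [← Matrix.mul_assoc, hf, Matrix.mul_assoc, red_mul_mul_comm hb, Matrix.mul_assoc]
        refine ⟨liftMatrix (f * red p b) * a, 0, ?_, ?_⟩
        · rw [← Matrix.mul_assoc, mul_liftMatrix hL (isShift_sigmaMatrix j) h1, Matrix.mul_assoc,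
            ← ha, Matrix.mul_assoc]
        · rw [red_mul, red_liftMatrix, cycTrace_zero, sub_zero, Matrix.mul_assoc]
      · refine ⟨0, f * h, by simp, ?_⟩
        rw [mul_cycTrace p _ hf, sub_self]
        ext; simp
    | zero => exact ⟨0, 0, by simp, by ext; simp [cycTrace_zero]⟩
    | add A B _ _ hA hB =>
      obtain ⟨P, h, h1, h2⟩ := hA
      obtain ⟨P', h', h1', h2'⟩ := hB
      refine ⟨P + P', h + h', by rw [Matrix.mul_add, Matrix.add_mul, h1, h1'], ?_⟩
      rw [red_add, h2, h2', cycTrace_add, Matrix.mul_add]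
      abel
    | smul c A _ hA =>
      obtain ⟨P, h, h1, h2⟩ := hA
      refine ⟨(c.val : ℤ) • P, c • h, by rw [Matrix.mul_smul, Matrix.smul_mul, h1], ?_⟩
      rw [red_smul, h2, cycTrace_smul, Matrix.mul_smul, smul_sub]
      simp
  simpa using this 1 hK

/-- Traces are radical on representations without Jordan blocks of size `p`. -/
theorem det_one_sub_cycTrace_ne_zero {L : Matrix J J (ZMod p)} (hL : (L - 1) ^ (p - 1) = 0)
    (h : Matrix J J (ZMod p)) : (1 - cycTrace p L L h).det ≠ 0 := by
  obtain ⟨X, rfl⟩ : ∃ X, L = 1 + X := ⟨L - 1, by abel⟩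
  rw [add_sub_cancel_left] at hL
  rw [cycTrace_one_add]
  intro hdet
  obtain ⟨v, hv, hv'⟩ := Matrix.exists_mulVec_eq_zero_iff.2 hdet
  rw [Matrix.sub_mulVec, Matrix.one_mulVec, sub_eq_zero] at hv'
  -- Descending induction on `l`. In a term `X^{l+g} h X^{p-1-g} v`, either `p - 1 - g ≥ l + 1` and
  -- the right factor kills `v`, or `l + g ≥ p - 1` and the left factor is zero.
  have key : ∀ d l, l + d = p - 1 → (X ^ l).mulVec v = 0 := by
    intro d
    induction d with
    | zero =>
      intro l hl
      rw [show l = p - 1 by omega, hL, Matrix.zero_mulVec]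
    | succ d ih =>
      intro l hl
      rw [hv', Matrix.mulVec_mulVec, cycTrace, Matrix.mul_sum, Matrix.sum_mulVec]
      refine Finset.sum_eq_zero fun g hg => ?_
      have hg' := Finset.mem_range.1 hg
      by_cases hlg : l + g < p - 1
      · have h1 := ih (l + 1) (by omega)
        have : p - 1 - g = (p - 1 - g - (l + 1)) + (l + 1) := by omega
        rw [this, pow_add X _ (l + 1)]
        simp only [← Matrix.mulVec_mulVec, h1, Matrix.mulVec_zero]
      · have : l + g = p - 1 + (l + g - (p - 1)) := by omega
        rw [← Matrix.mul_assoc, ← Matrix.mul_assoc, ← pow_add, this, pow_add, hL]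
        simp
  apply hv
  simpa using key (p - 1) 0 (by omega)

/-- A direct summand of the reduction of `K` without Jordan blocks of size `p` lifts, up to
traces, to an integral equivariant summand. -/
theorem IsStablyJordan.exists_split_lift {K : Matrix I I ℤ} (hK : IsStablyJordan p K)
    {L : Matrix J J ℤ} (hL : IsShift L) (hLp : (red p L - 1) ^ (p - 1) = 0)
    {f : Matrix I J (ZMod p)} {g : Matrix J I (ZMod p)} (hf : red p K * f = f * red p L)
    (hg : red p L * g = g * red p K) (hgf : g * f = 1) :
    ∃ (P : Matrix I J ℤ) (Q : Matrix J I ℤ), K * P = P * L ∧ L * Q = Q * K ∧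
      ((Q * P).det : ZMod p) ≠ 0 := by
  obtain ⟨P, h, hP, hP'⟩ := hK.exists_lift_into hL hf
  obtain ⟨Q, k, hQ, hQ'⟩ := hK.exists_lift_from hL hg
  refine ⟨P, Q, hP, hQ, ?_⟩
  -- The errors of `P` and `Q` are composed with equivariant maps only, so they merge into one
  -- trace.
  have h1 : red p (Q * P) = 1 - cycTrace p (red p L) (red p L) (g * h + k * red p P) := by
    rw [red_mul, hQ', Matrix.sub_mul, cycTrace_mul p _ (red_mul_mul_comm hP), cycTrace_add,
      ← mul_cycTrace p _ hg, hP', Matrix.mul_sub, hgf]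
    abel
  have h2 : ((Q * P).det : ZMod p) = (red p (Q * P)).det := Int.cast_det _
  rw [h2, h1]
  exact det_one_sub_cycTrace_ne_zero hLp _

end lift

/-! ### From matrices to subrepresentations. -/

section representation
variable {k G E S : Type*} [Field k] [Group G] [AddCommGroup E] [Module k E] [AddCommGroup S]
  [Module k S] {ρ : Representation k G E} {τ : Representation k G S}

/-- A linear map commuting with a generator of the group is equivariant. -/
theorem commutes_of_generator {g₀ : G} (hg : ∀ g, g ∈ Subgroup.zpowers g₀) {f : S →ₗ[k] E}
    (hf : ∀ v, f (τ g₀ v) = ρ g₀ (f v)) (g : G) (v : S) : f (τ g v) = ρ g (f v) := by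
  have hinv : ∀ v, f (τ g₀⁻¹ v) = ρ g₀⁻¹ (f v) := by
    intro v
    have h := hf (τ g₀⁻¹ v)
    rw [Representation.self_inv_apply] at h
    rw [h, Representation.inv_self_apply]
  obtain ⟨n, rfl⟩ := hg g
  change f (τ (g₀ ^ n) v) = ρ (g₀ ^ n) (f v)
  induction n using Int.induction_on generalizing v with
  | zero => simp
  | succ n ih => rw [zpow_add_one, map_mul, map_mul, Module.End.mul_apply, Module.End.mul_apply,
      ih, hf]
  | pred n ih => rw [zpow_sub_one, map_mul, map_mul, Module.End.mul_apply, Module.End.mul_apply,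
      ih, hinv]

variable {I J : Type*} [Fintype I] [Fintype J]

/-- The intertwining map given in coordinates by a matrix that commutes with the matrices of a
generator. -/
def intertwiningOfMatrix {g₀ : G} (hg : ∀ g, g ∈ Subgroup.zpowers g₀) {e : E ≃ₗ[k] (I → k)}
    {A : Matrix I I k} (he : ∀ v, e (ρ g₀ v) = A.mulVec (e v)) {d : S ≃ₗ[k] (J → k)}
    {B : Matrix J J k} (hd : ∀ v, d (τ g₀ v) = B.mulVec (d v)) (P : Matrix I J k)
    (hP : A * P = P * B) : τ.IntertwiningMap ρ :=
  LinearMap.intertwiningMap_of_isIntertwiningMap τ ρ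
    (e.symm.toLinearMap ∘ₗ P.mulVecLin ∘ₗ d.toLinearMap) <|
    commutes_of_generator hg fun v => by
      apply e.injective
      simp only [LinearMap.comp_apply, LinearEquiv.coe_coe, Matrix.mulVecLin_apply,
        LinearEquiv.apply_symm_apply, he, hd, Matrix.mulVec_mulVec, hP]

theorem intertwiningOfMatrix_apply {g₀ : G} (hg : ∀ g, g ∈ Subgroup.zpowers g₀)
    {e : E ≃ₗ[k] (I → k)}
    {A : Matrix I I k} (he : ∀ v, e (ρ g₀ v) = A.mulVec (e v)) {d : S ≃ₗ[k] (J → k)}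
    {B : Matrix J J k} (hd : ∀ v, d (τ g₀ v) = B.mulVec (d v)) (P : Matrix I J k)
    (hP : A * P = P * B) (v : S) :
    e (intertwiningOfMatrix hg he hd P hP v) = P.mulVec (d v) :=
  e.apply_symm_apply _

/-- The complement is the kernel of `g`. -/
theorem isComplemented_range (f : τ.IntertwiningMap ρ) (g : ρ.IntertwiningMap τ)
    (h : Function.Bijective (g.comp f)) : IsComplemented f.range := by
  refine ⟨g.ker, IsCompl.of_eq ?_ ?_⟩
  · apply Subrepresentation.toSubmodule_injective
    change LinearMap.range f.toLinearMap ⊓ LinearMap.ker g.toLinearMap = ⊥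
    rw [Submodule.eq_bot_iff]
    rintro _ ⟨⟨v, rfl⟩, hv⟩
    have h0 : (g.comp f) v = (g.comp f) 0 := by
      rw [map_zero]
      exact hv
    rw [h.1 h0, map_zero]
  · apply Subrepresentation.toSubmodule_injective
    change LinearMap.range f.toLinearMap ⊔ LinearMap.ker g.toLinearMap = ⊤
    rw [Submodule.eq_top_iff']
    intro v
    obtain ⟨w, hw⟩ := h.2 (g v)
    rw [← add_sub_cancel (f w) v]
    refine Submodule.add_mem_sup ⟨w, rfl⟩ ?_
    rw [LinearMap.mem_ker]
    change g (v - f w) = 0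
    rw [map_sub, sub_eq_zero]
    exact hw.symm

theorem nonempty_equiv_range (f : τ.IntertwiningMap ρ) (h : Function.Injective f) :
    Nonempty (f.range.toRepresentation.Equiv τ) :=
  ⟨(Representation.Equiv.mk (LinearEquiv.ofInjective f.toLinearMap h) fun g => by
    ext v
    exact Representation.IntertwiningMap.isIntertwining _ _ f g v).symm⟩

/-- Every nonzero subrepresentation contains the last basis vector: a suitable power of `σ - 1`
moves the first nonzero coordinate of a vector to the last place and pushes the others out. So two
of them are never disjoint. -/
theorem isIndecomposable_of_jordan {g₀ : G} {n : ℕ} (hn : 1 ≤ n) (e : E ≃ₗ[k] (Fin n → k))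
    (he : ∀ v, e (ρ g₀ v) = (sigmaMatrix k n).mulVec (e v)) : IsIndecomposable ρ := by
  obtain ⟨m, rfl⟩ : ∃ m, n = m + 1 := ⟨n - 1, by omega⟩
  have hX : ∀ (A : Subrepresentation ρ) (q : ℕ), ∀ v ∈ A.toSubmodule,
      e.symm (((sigmaMatrix k (m + 1) - 1) ^ q).mulVec (e v)) ∈ A.toSubmodule := by
    intro A q
    induction q with
    | zero => intro v hv; simpa using hv
    | succ q ih =>
      intro v hv
      have h := ih _ (A.toSubmodule.sub_mem (A.apply_mem_toSubmodule g₀ hv) hv)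
      rw [map_sub, he] at h
      rw [pow_succ, ← Matrix.mulVec_mulVec, Matrix.sub_mulVec, Matrix.one_mulVec]
      exact h
  have key : ∀ A : Subrepresentation ρ, A ≠ ⊥ →
      e.symm (Pi.single (Fin.last m) 1) ∈ A.toSubmodule := by
    intro A hA
    have hA' : A.toSubmodule ≠ ⊥ := fun h => hA (Subrepresentation.toSubmodule_injective h)
    obtain ⟨v, hv, hv0⟩ := Submodule.exists_mem_ne_zero_of_ne_bot hA'
    have hev : ∃ q : ℕ, ∃ h : q < m + 1, e v ⟨q, h⟩ ≠ 0 := by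
      by_contra! h
      apply hv0
      rw [← e.map_eq_zero_iff]
      ext i
      exact h i i.2
    classical
    have hlt : Nat.find hev < m + 1 := (Nat.find_spec hev).1
    have hne : e v ⟨Nat.find hev, hlt⟩ ≠ 0 := (Nat.find_spec hev).2
    have hmin : ∀ j : Fin (m + 1), (j : ℕ) < Nat.find hev → e v j = 0 := by
      intro j hj
      have := Nat.find_min hev hj
      push Not at this
      exact this j.2
    have h1 : ((sigmaMatrix k (m + 1) - 1) ^ (m - Nat.find hev)).mulVec (e v) =
        e v ⟨Nat.find hev, hlt⟩ • Pi.single (Fin.last m) 1 := by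
      ext i
      rw [Matrix.mulVec, dotProduct]
      simp only [sigmaMatrix_sub_one_pow_eq, ite_mul, one_mul, zero_mul, Pi.smul_apply,
        Pi.single_apply, smul_eq_mul, mul_ite, mul_one, mul_zero]
      by_cases hi : i = Fin.last m
      · rw [if_pos hi, Finset.sum_eq_single ⟨Nat.find hev, hlt⟩]
        · rw [if_pos]
          rw [hi, Fin.val_last]
          simp only
          omega
        · intro j _ hj
          rw [if_neg]
          intro h
          apply hj
          ext
          rw [hi, Fin.val_last] at h
          simp only
          omega
        · simp
      · rw [if_neg hi]
        refine Finset.sum_eq_zero fun j _ => ?_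
        split_ifs with h
        · apply hmin
          have : (i : ℕ) ≠ m := fun h' => hi (Fin.ext h')
          have := i.2
          omega
        · rfl
    have h2 := hX A (m - Nat.find hev) v hv
    rw [h1, map_smul] at h2
    exact (Submodule.smul_mem_iff _ hne).1 h2
  refine ⟨e.toEquiv.nontrivial, fun A B hAB => ?_⟩
  by_contra! h
  have h1 : e.symm (Pi.single (Fin.last m) 1) ∈ (A ⊓ B).toSubmodule := ⟨key A h.1, key B h.2⟩
  rw [hAB.inf_eq_bot] at h1
  have h2 : e.symm (Pi.single (Fin.last m) 1) = 0 := h1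
  rw [e.symm.map_eq_zero_iff] at h2
  simpa using congrFun h2 (Fin.last m)

end representation

section blocks
variable {k G E X : Type*} [Field k] [Group G] [AddCommGroup E] [Module k E] [DecidableEq X]
  {T : X → Type*} [∀ x, AddCommGroup (T x)] [∀ x, Module k (T x)]
  {ρ : Representation k G E} {τ : ∀ x, Representation k G (T x)}

/-- The restriction of an intertwining map from a direct sum to a summand. -/
def blockMap (f : (Representation.directSum τ).IntertwiningMap ρ) (x : X) :
    (τ x).IntertwiningMap ρ :=
  LinearMap.intertwiningMap_of_isIntertwiningMap _ _ (f.toLinearMap ∘ₗ DirectSum.lof k X T x)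
    fun g v => by
      have h := Representation.IntertwiningMap.isIntertwining _ _ f g (DirectSum.lof k X T x v)
      rw [Representation.directSum_apply, DirectSum.lmap_lof] at h
      exact h

theorem blockMap_injective {f : (Representation.directSum τ).IntertwiningMap ρ}
    (hf : Function.Injective f) (x : X) : Function.Injective (blockMap f x) :=
  hf.comp (DirectSum.of_injective x)

theorem isInternalSum_blockMap {f : (Representation.directSum τ).IntertwiningMap ρ}
    (hf : Function.Injective f) : IsInternalSum (fun x => (blockMap f x).range) f.range := by
  have h1 : ∀ x, (blockMap f x).range.toSubmodule =
      (LinearMap.range (DirectSum.lof k X T x)).map f.toLinearMap := fun x =>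
    LinearMap.range_comp _ _
  constructor
  · intro x
    simp only [h1]
    simp only [← Submodule.map_iSup]
    rw [disjoint_iff, ← Submodule.map_inf _ hf]
    have h2 : ⨆ y, ⨆ (_ : y ≠ x), LinearMap.range (DirectSum.lof k X T y) ≤
        LinearMap.ker (DirectSum.component k X T x) := by
      refine iSup₂_le fun y hy => ?_
      rintro _ ⟨v, rfl⟩
      rw [LinearMap.mem_ker, DirectSum.component.of, dif_neg hy]
    have h3 : LinearMap.range (DirectSum.lof k X T x) ⊓
        ⨆ y, ⨆ (_ : y ≠ x), LinearMap.range (DirectSum.lof k X T y) = ⊥ := by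
      rw [Submodule.eq_bot_iff]
      rintro _ ⟨⟨v, rfl⟩, hv⟩
      have h4 := h2 hv
      rw [LinearMap.mem_ker, DirectSum.component.lof_self] at h4
      rw [h4, map_zero]
    rw [h3, Submodule.map_bot]
  · simp only [h1]
    rw [← Submodule.map_iSup]
    have : ⨆ x, LinearMap.range (DirectSum.lof k X T x) = ⊤ :=
      DFinsupp.iSup_range_lsingle
    rw [this, Submodule.map_top]
    rfl

end blocks

/-! ### Coordinates on tensor products and direct sums. -/

section tensorCoord
variable (R : Type*) [CommRing R] {r : ℕ} (n : Fin r → ℕ)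

/-- Coordinates on `⊗_k R^{n_k}` with respect to the basis of elementary tensors. -/
def tensorCoord : (⨂[R] k, (Fin (n k) → R)) ≃ₗ[R] ((∀ k, Fin (n k)) → R) :=
  (Basis.piTensorProduct fun k => Pi.basisFun R (Fin (n k))).equivFun

theorem tensorCoord_tprod (v : ∀ k, Fin (n k) → R) (i : ∀ k, Fin (n k)) :
    tensorCoord R n (PiTensorProduct.tprod R v) i = ∏ k, v k (i k) := by
  simp [tensorCoord]

theorem tensorCoord_fromIntegral (t : ⨂[ℤ] k, (Fin (n k) → ℤ)) :
    tensorCoord R n (fromIntegral R n t) = fun i => ((tensorCoord ℤ n t i : ℤ) : R) := by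
  ext i
  induction t using PiTensorProduct.induction_on with
  | smul_tprod c v =>
    rw [map_zsmul, fromIntegral_tprod, map_zsmul, map_smul]
    simp [tensorCoord_tprod]
  | add x y hx hy => simp only [map_add, Pi.add_apply, hx, hy, Int.cast_add]

theorem tensorCoord_map (A : ∀ k, Matrix (Fin (n k)) (Fin (n k)) R)
    (t : ⨂[R] k, (Fin (n k) → R)) :
    tensorCoord R n (PiTensorProduct.map (fun k => Matrix.toLin' (A k)) t) =
      (Matrix.of fun i j : ∀ k, Fin (n k) => ∏ k, A k (i k) (j k)).mulVec (tensorCoord R n t) := by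
  induction t using PiTensorProduct.induction_on with
  | smul_tprod c v =>
    simp only [map_smul, Matrix.mulVec_smul]
    congr 1
    ext i
    rw [PiTensorProduct.map_tprod, tensorCoord_tprod]
    simp only [Matrix.toLin'_apply, Matrix.mulVec, dotProduct, Matrix.of_apply, tensorCoord_tprod,
      ← Finset.prod_mul_distrib]
    rw [Finset.prod_univ_sum, Fintype.piFinset_univ]
  | add x y hx hy => simp only [map_add, Matrix.mulVec_add, hx, hy]

theorem map_castRingHom_tensorMatrix :
    (tensorMatrix ℤ n).map (Int.castRingHom R) = tensorMatrix R n := by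
  ext i j
  simp only [tensorMatrix, Matrix.map_apply, Matrix.of_apply, map_prod]
  refine Finset.prod_congr rfl fun k _ => ?_
  rw [← map_castRingHom_sigmaMatrix R, Matrix.map_apply]

end tensorCoord

theorem mem_zpowers_ofAdd_one_int (g : Multiplicative ℤ) :
    g ∈ Subgroup.zpowers (Multiplicative.ofAdd (1 : ℤ)) :=
  ⟨g.toAdd, by
    change Multiplicative.ofAdd (1 : ℤ) ^ g.toAdd = g
    rw [← ofAdd_zsmul, smul_eq_mul, mul_one, ofAdd_toAdd]⟩

theorem mem_zpowers_ofAdd_one_zmod (p : ℕ) [NeZero p] (g : Multiplicative (ZMod p)) :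
    g ∈ Subgroup.zpowers (Multiplicative.ofAdd (1 : ZMod p)) :=
  ⟨g.toAdd.val, by
    change Multiplicative.ofAdd (1 : ZMod p) ^ (g.toAdd.val : ℤ) = g
    rw [zpow_natCast, ← ofAdd_nsmul, nsmul_eq_mul, mul_one, ZMod.natCast_zmod_val, ofAdd_toAdd]⟩

theorem M_generator (n : ℕ) :
    M n (Multiplicative.ofAdd 1) = Matrix.toLin' (sigmaMatrix ℚ n) := by
  change Matrix.toLin' ((sigma ℚ n ^ (1 : ℤ) : (Matrix (Fin n) (Fin n) ℚ)ˣ) :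
    Matrix (Fin n) (Fin n) ℚ) = _
  rw [zpow_one]
  rfl

theorem V_generator (p : ℕ) [Fact p.Prime] {n : ℕ} (hn : n ≤ p) :
    V p n hn (Multiplicative.ofAdd 1) = Matrix.toLin' (sigmaMatrix (ZMod p) n) := by
  have : Fact (1 < p) := ⟨(Fact.out : p.Prime).one_lt⟩
  change Matrix.toLin' ((sigma (ZMod p) n ^ (1 : ZMod p).val :
    (Matrix (Fin n) (Fin n) (ZMod p))ˣ) : Matrix (Fin n) (Fin n) (ZMod p)) = _
  rw [ZMod.val_one, pow_one]
  rfl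

theorem tensorCoord_tensorRep_M {r : ℕ} (n : Fin r → ℕ) (t : ⨂[ℚ] k, (Fin (n k) → ℚ)) :
    tensorCoord ℚ n (tensorRep (fun k => M (n k)) (Multiplicative.ofAdd 1) t) =
      (tensorMatrix ℚ n).mulVec (tensorCoord ℚ n t) := by
  rw [tensorMatrix, ← tensorCoord_map]
  change tensorCoord ℚ n (PiTensorProduct.map (fun k => M (n k) (Multiplicative.ofAdd 1)) t) = _
  simp only [M_generator]

theorem tensorCoord_tensorRep_V (p : ℕ) [Fact p.Prime] {r : ℕ} (n : Fin r → ℕ)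
    (hn : ∀ k, n k ≤ p) (t : ⨂[ZMod p] k, (Fin (n k) → ZMod p)) :
    tensorCoord (ZMod p) n
      (tensorRep (fun k => V p (n k) (hn k)) (Multiplicative.ofAdd 1) t) =
      (tensorMatrix (ZMod p) n).mulVec (tensorCoord (ZMod p) n t) := by
  rw [tensorMatrix, ← tensorCoord_map]
  change tensorCoord (ZMod p) n
    (PiTensorProduct.map (fun k => V p (n k) (hn k) (Multiplicative.ofAdd 1)) t) = _
  simp only [V_generator]

section sumCoord
variable {k X : Type*} [Field k] [Fintype X] (s : X → ℕ)

variable (k) in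
/-- Coordinates on a direct sum of standard spaces. -/
def sumCoord : (⨁ x, (Fin (s x) → k)) ≃ₗ[k] ((Σ x, Fin (s x)) → k) :=
  (DirectSum.linearEquivFunOnFintype k X fun x => Fin (s x) → k).trans
    (LinearEquiv.piCurry k fun (x : X) (_ : Fin (s x)) => k).symm

theorem sumCoord_apply (v : ⨁ x, (Fin (s x) → k)) (x : X) (i : Fin (s x)) :
    sumCoord k s v ⟨x, i⟩ = v x i := rfl

variable [DecidableEq X]

theorem blockSigma_mulVec (w : (Σ x, Fin (s x)) → k) (x : X) (i : Fin (s x)) :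
    (blockSigma k s).mulVec w ⟨x, i⟩ = (sigmaMatrix k (s x)).mulVec (fun l => w ⟨x, l⟩) i := by
  simp only [Matrix.mulVec, dotProduct]
  rw [Fintype.sum_sigma, Finset.sum_eq_single x]
  · simp [blockSigma, Matrix.blockDiagonal'_apply_eq]
  · intro y _ hy
    refine Finset.sum_eq_zero fun l _ => ?_
    rw [blockSigma, Matrix.blockDiagonal'_apply_ne _ _ _ hy.symm, zero_mul]
  · simp

theorem sumCoord_lof (x : X) (v : Fin (s x) → k) (y : X) (i : Fin (s y)) (hy : y ≠ x) :
    sumCoord k s (DirectSum.lof k X (fun x => Fin (s x) → k) x v) ⟨y, i⟩ = 0 := by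
  rw [sumCoord_apply, DirectSum.lof_eq_of, DirectSum.of_eq_of_ne _ _ _ hy]
  rfl

theorem exists_lof_of_sumCoord_eq_zero (x : X) (w : (Σ x, Fin (s x)) → k)
    (hw : ∀ j : (Σ x, Fin (s x)), j.1 ≠ x → w j = 0) :
    sumCoord k s (DirectSum.lof k X (fun x => Fin (s x) → k) x fun i => w ⟨x, i⟩) = w := by
  ext ⟨y, i⟩
  by_cases hy : y = x
  · subst hy
    rw [sumCoord_apply, DirectSum.lof_apply]
  · rw [sumCoord_lof s x _ y i hy, hw _ hy]

theorem sumCoord_directSum {G : Type*} [Monoid G] {g : G}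
    (τ : ∀ x, Representation k G (Fin (s x) → k))
    (hτ : ∀ x, τ x g = Matrix.toLin' (sigmaMatrix k (s x))) (v : ⨁ x, (Fin (s x) → k)) :
    sumCoord k s (Representation.directSum τ g v) = (blockSigma k s).mulVec (sumCoord k s v) := by
  ext ⟨x, i⟩
  rw [blockSigma_mulVec, sumCoord_apply, Representation.directSum_apply, DirectSum.lmap_apply, hτ]
  rfl

end sumCoord

/-! ### Reduction of integral points. -/

section reduction
variable {p : ℕ} [Fact p.Prime] {r : ℕ} {n : Fin r → ℕ} {J : Type} [Fintype J] [DecidableEq J]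

/-- The reduction of the subspace spanned over `ℚ` by some columns of an integer matrix that is
split injective modulo `p` is spanned by the reductions of these columns. -/
theorem reduction_eq {P : Matrix (∀ k, Fin (n k)) J ℤ} {Q : Matrix J (∀ k, Fin (n k)) ℤ}
    (hd : ((Q * P).det : ZMod p) ≠ 0) (C : Set J)
    {N : Submodule ℚ (⨂[ℚ] k, (Fin (n k) → ℚ))}
    {W : Submodule (ZMod p) (⨂[ZMod p] k, (Fin (n k) → ZMod p))}
    (hN : ∀ t, t ∈ N ↔ ∃ w : J → ℚ, (∀ j ∉ C, w j = 0) ∧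
      tensorCoord ℚ n t = (P.map (Int.castRingHom ℚ)).mulVec w)
    (hW : ∀ t, t ∈ W ↔ ∃ w : J → ZMod p, (∀ j ∉ C, w j = 0) ∧
      tensorCoord (ZMod p) n t = (P.map (Int.castRingHom (ZMod p))).mulVec w) :
    reduction p N = W.toAddSubgroup := by
  have hcast : ∀ (R : Type) [CommRing R] {I' J' : Type} [Fintype J'] (A : Matrix I' J' ℤ)
      (w : J' → ℤ), (fun i => ((A.mulVec w i : ℤ) : R)) =
        (A.map (Int.castRingHom R)).mulVec fun j => (w j : R) := by
    intro R _ I' J' _ A w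
    ext i
    simp [Matrix.mulVec, dotProduct]
  ext t
  constructor
  · rintro ⟨y, hy, rfl⟩
    obtain ⟨w, hw, hyw⟩ := (hN _).1 hy
    rw [tensorCoord_fromIntegral] at hyw
    set z := tensorCoord ℤ n y with hz
    set D := (Q * P).det with hD
    have hsmul : (D • (1 : Matrix J J ℤ)).map (Int.castRingHom ℚ) = (D : ℚ) • 1 := by
      ext a b
      simp only [Matrix.map_apply, Matrix.smul_apply, Matrix.one_apply]
      split_ifs <;> simp
    -- With `z = P w` for a rational `w`, this integral vector is `D • w`. It has the same support
    -- as `w`, and `D` can be inverted after reduction.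
    let w' : J → ℤ := ((Q * P).adjugate * Q).mulVec z
    have hw' : (fun j => (w' j : ℚ)) = (D : ℚ) • w := by
      rw [hcast ℚ, hyw, Matrix.mulVec_mulVec, ← Matrix.map_mul, Matrix.mul_assoc,
        Matrix.adjugate_mul, ← hD, hsmul, Matrix.smul_mulVec, Matrix.one_mulVec]
    have hPw : P.mulVec w' = D • z := by
      have h : (fun i => ((P.mulVec w' i : ℤ) : ℚ)) = fun i => (((D • z) i : ℤ) : ℚ) := by
        rw [hcast ℚ, hw', Matrix.mulVec_smul, ← hyw]
        ext i
        simp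
      ext i
      exact_mod_cast congrFun h i
    refine (hW _).2 ⟨fun j => (D : ZMod p)⁻¹ * w' j, fun j hj => ?_, ?_⟩
    · have h := congrFun hw' j
      rw [Pi.smul_apply, hw j hj, smul_zero] at h
      change (D : ZMod p)⁻¹ * (w' j : ZMod p) = 0
      rw [Int.cast_eq_zero.1 h, Int.cast_zero, mul_zero]
    · have h := hcast (ZMod p) P w'
      have h2 : (fun j => (D : ZMod p)⁻¹ * (w' j : ZMod p)) =
          (D : ZMod p)⁻¹ • fun j => (w' j : ZMod p) := rfl
      rw [tensorCoord_fromIntegral, h2, Matrix.mulVec_smul, ← h, hPw]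
      ext i
      simp [← hz, inv_mul_cancel_left₀ hd]
  · intro ht
    obtain ⟨w, hw, htw⟩ := (hW t).1 ht
    let wZ : J → ℤ := fun j => ((w j).val : ℤ)
    refine ⟨(tensorCoord ℤ n).symm (P.mulVec wZ), ?_, ?_⟩
    · refine (hN _).2 ⟨fun j => (wZ j : ℚ), fun j hj => ?_, ?_⟩
      · simp [wZ, hw j hj]
      · rw [tensorCoord_fromIntegral, LinearEquiv.apply_symm_apply, hcast ℚ]
    · apply (tensorCoord (ZMod p) n).injective
      rw [tensorCoord_fromIntegral, LinearEquiv.apply_symm_apply, hcast (ZMod p), htw]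
      simp [wZ]

end reduction

/-! ### Jordan form of nilpotent endomorphisms. -/

section jordan
variable {F : Type*} [Field F]

/-- A nilpotent endomorphism splits off a Jordan block whose size is its order. -/
theorem exists_split_jordan_block {V : Type*} [AddCommGroup V] [Module F V] {N : Module.End F V}
    {m : ℕ} (h1 : N ^ (m + 1) = 0) (h0 : N ^ m ≠ 0) :
    ∃ (U : Submodule F V) (hU : ∀ u ∈ U, N u ∈ U) (e : V ≃ₗ[F] (Fin (m + 1) → F) × U), U ≠ ⊤ ∧
      ∀ v, e (N v) = ((sigmaMatrix F (m + 1) - 1).mulVec (e v).1, N.restrict hU (e v).2) := by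
  obtain ⟨v, hv⟩ : ∃ v, (N ^ m) v ≠ 0 := by
    by_contra! h
    exact h0 (LinearMap.ext h)
  obtain ⟨f, hf⟩ : ∃ f : Module.Dual F V, f ((N ^ m) v) ≠ 0 := by
    by_contra! h
    exact hv ((Module.forall_dual_apply_eq_zero_iff F _).1 h)
  have hN : ∀ i, m + 1 ≤ i → ∀ w, (N ^ i) w = 0 := by
    intro i hi w
    rw [pow_eq_zero_of_le hi h1, LinearMap.zero_apply]
  -- `P` spans the chain of `v`, and `Q` reads coordinates with `f`. The matrix of `Q ∘ P` is
  -- triangular with diagonal entries `f (N^m v) ≠ 0`, so `ker Q` is a stable complement of the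
  -- range of `P`.
  let P : (Fin (m + 1) → F) →ₗ[F] V :=
    ∑ i : Fin (m + 1), (LinearMap.proj i).smulRight ((N ^ (i : ℕ)) v)
  let Q : V →ₗ[F] (Fin (m + 1) → F) := LinearMap.pi fun i => f ∘ₗ (N ^ (m - (i : ℕ)))
  have hP : ∀ c, P c = ∑ i, c i • (N ^ (i : ℕ)) v := fun c => by simp [P]
  have hPN : ∀ c, N (P c) = P ((sigmaMatrix F (m + 1) - 1).mulVec c) := by
    intro c
    simp only [hP, map_sum, map_smul, Matrix.mulVec, dotProduct, Finset.sum_smul,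
      sigmaMatrix_sub_one_apply, ite_mul, one_mul, zero_mul, ite_smul, zero_smul]
    rw [Finset.sum_comm]
    refine Finset.sum_congr rfl fun j _ => ?_
    rw [← Module.End.mul_apply, ← pow_succ']
    by_cases hj : (j : ℕ) + 1 < m + 1
    · rw [Finset.sum_eq_single ⟨j + 1, hj⟩]
      · simp
      · intro i _ hi
        rw [if_neg fun h => hi (Fin.ext h)]
      · simp
    · rw [hN _ (by omega), smul_zero]
      refine (Finset.sum_eq_zero fun i _ => ?_).symm
      rw [if_neg (by omega)]
  have hQN : ∀ w, Q (N w) = (sigmaMatrix F (m + 1) - 1).mulVec (Q w) := by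
    intro w
    ext i
    simp only [Q, LinearMap.pi_apply, LinearMap.comp_apply, Matrix.mulVec, dotProduct,
      sigmaMatrix_sub_one_apply, ite_mul, one_mul, zero_mul]
    rw [← Module.End.mul_apply, ← pow_succ]
    by_cases hi : (i : ℕ) = 0
    · rw [hN _ (by omega), map_zero]
      refine (Finset.sum_eq_zero fun j _ => ?_).symm
      rw [if_neg (by omega)]
    · rw [Finset.sum_eq_single ⟨i - 1, by omega⟩]
      · simp only
        rw [if_pos (by omega), show m - (i : ℕ) + 1 = m - ((i : ℕ) - 1) by omega]
      · intro j _ hj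
        rw [if_neg fun h => hj (Fin.ext (by simp only; omega))]
      · simp
  have hinj : ∀ c, Q (P c) = 0 → c = 0 := by
    intro c hc
    have key : ∀ a : ℕ, ∀ h : a < m + 1, c ⟨a, h⟩ = 0 := by
      intro a
      induction a using Nat.strong_induction_on with
      | _ a ih =>
        intro ha
        have h2 := congrFun hc ⟨a, ha⟩
        simp only [Q, LinearMap.pi_apply, LinearMap.comp_apply, hP, map_sum, map_smul,
          Pi.zero_apply, ← Module.End.mul_apply, ← pow_add] at h2
        rw [Finset.sum_eq_single ⟨a, ha⟩] at h2
        · simp only at h2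
          rw [Nat.sub_add_cancel (by omega), smul_eq_mul] at h2
          exact (mul_eq_zero.1 h2).resolve_right hf
        · intro j _ hj
          have hj' : (j : ℕ) ≠ a := fun h => hj (Fin.ext h)
          by_cases hja : (j : ℕ) < a
          · rw [ih j hja j.2, zero_smul]
          · rw [hN _ (by omega), map_zero, smul_zero]
        · simp
    ext i
    exact key i i.2
  have hinj' : Function.Injective (Q ∘ₗ P) := (injective_iff_map_eq_zero _).2 hinj
  have hsurj : Function.Surjective (Q ∘ₗ P) := LinearMap.injective_iff_surjective.1 hinj'
  have hU : ∀ u ∈ LinearMap.ker Q, N u ∈ LinearMap.ker Q := by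
    intro u hu
    rw [LinearMap.mem_ker] at hu ⊢
    rw [hQN, hu, Matrix.mulVec_zero]
  let G : (Fin (m + 1) → F) × LinearMap.ker Q →ₗ[F] V := P.coprod (LinearMap.ker Q).subtype
  have hG : ∀ x, G x = P x.1 + x.2 := fun x => by simp [G]
  have hGb : Function.Bijective G := by
    constructor
    · rw [injective_iff_map_eq_zero]
      rintro ⟨c, u, hu⟩ h
      rw [hG] at h
      have hc : c = 0 := by
        apply hinj
        have := congrArg Q h
        rwa [map_add, LinearMap.mem_ker.1 hu, add_zero, map_zero] at this
      subst hc
      simpa using h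
    · intro w
      obtain ⟨c, hc⟩ := hsurj (Q w)
      refine ⟨(c, ⟨w - P c, ?_⟩), by simp [hG]⟩
      rw [LinearMap.mem_ker, map_sub, sub_eq_zero]
      exact hc.symm
  refine ⟨LinearMap.ker Q, hU, (LinearEquiv.ofBijective G hGb).symm, ?_, ?_⟩
  · intro htop
    have h2 : Q = 0 := LinearMap.ker_eq_top.1 htop
    obtain ⟨c, hc⟩ := exists_ne (0 : Fin (m + 1) → F)
    exact hc (hinj c (by rw [h2, LinearMap.zero_apply]))
  · intro w
    rw [LinearEquiv.symm_apply_eq, LinearEquiv.ofBijective_apply, hG]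
    have h3 : w = G ((LinearEquiv.ofBijective G hGb).symm w) :=
      ((LinearEquiv.ofBijective G hGb).apply_symm_apply w).symm
    conv_lhs => rw [h3, hG]
    rw [map_add, hPN]
    rfl

/-- Jordan decomposition of a nilpotent endomorphism. -/
theorem exists_jordan_decomposition {q : ℕ} {V : Type*} [AddCommGroup V] [Module F V]
    [FiniteDimensional F V] (N : Module.End F V) (hN : N ^ q = 0) :
    ∃ (X : Type) (_ : Fintype X) (s : X → ℕ) (e : V ≃ₗ[F] ∀ x, Fin (s x) → F),
      (∀ x, 1 ≤ s x ∧ s x ≤ q) ∧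
      ∀ v x, e (N v) x = (sigmaMatrix F (s x) - 1).mulVec (e v x) := by
  induction hd : Module.finrank F V using Nat.strong_induction_on generalizing V with
  | _ d ih =>
    rcases subsingleton_or_nontrivial V with hV | hV
    · exact ⟨Empty, inferInstance, Empty.elim, 0, fun x => x.elim, fun _ x => x.elim⟩
    classical
    have hex : ∃ q, N ^ q = 0 := ⟨q, hN⟩
    obtain ⟨m, hm⟩ : ∃ m, Nat.find hex = m + 1 := by
      refine ⟨Nat.find hex - 1, ?_⟩
      have : Nat.find hex ≠ 0 := fun h => by
        have h2 := Nat.find_spec hex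
        rw [h, pow_zero] at h2
        exact one_ne_zero h2
      omega
    have h1 : N ^ (m + 1) = 0 := hm ▸ Nat.find_spec hex
    have h0 : N ^ m ≠ 0 := Nat.find_min hex (by omega)
    have hmq : m + 1 ≤ q := hm ▸ Nat.find_min' hex hN
    obtain ⟨U, hU, e, hUtop, he⟩ := exists_split_jordan_block h1 h0
    have hNU : (N.restrict hU) ^ q = 0 := by
      rw [Module.End.pow_restrict]
      ext u
      simp [hN]
    obtain ⟨X, _, s, e', hs, he'⟩ := ih _ (hd ▸ Submodule.finrank_lt hUtop) _ hNU rfl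
    let s' : Option X → ℕ := fun o => o.elim (m + 1) s
    refine ⟨Option X, inferInstance, s', (e.trans ((LinearEquiv.refl F _).prodCongr e')).trans
      (LinearEquiv.piOptionEquivProd F (M := fun o => Fin (s' o) → F)).symm, ?_, ?_⟩
    · rintro (_ | x)
      · exact ⟨Nat.succ_le_succ (Nat.zero_le m), hmq⟩
      · exact hs x
    · rintro v (_ | x)
      · exact congrArg Prod.fst (he v)
      · have h2 := congrFun (congrArg e' (congrArg Prod.snd (he v))) x
        exact h2.trans (he' _ x)

end jordan

/-! ### Direct summands from split matrices. -/

section coordinates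
variable {k G E S : Type*} [Field k] [Group G] [AddCommGroup E] [Module k E] [AddCommGroup S]
  [Module k S] {ρ : Representation k G E} {τ : Representation k G S} {I J : Type*} [Fintype I]
  [Fintype J] [DecidableEq J]

/-- The matrices of an equivalence of representations and of its inverse. -/
theorem exists_matrices_of_equiv [DecidableEq I] {g₀ : G} {e : E ≃ₗ[k] (I → k)} {A : Matrix I I k}
    (he : ∀ v, e (ρ g₀ v) = A.mulVec (e v)) {d : S ≃ₗ[k] (J → k)} {B : Matrix J J k}
    (hd : ∀ v, d (τ g₀ v) = B.mulVec (d v)) (φ : ρ.Equiv τ) :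
    ∃ (P : Matrix I J k) (Q : Matrix J I k), A * P = P * B ∧ B * Q = Q * A ∧ Q * P = 1 := by
  obtain ⟨ψ, hψ⟩ : ∃ ψ : E ≃ₗ[k] S, ∀ u, ψ (ρ g₀ u) = τ g₀ (ψ u) :=
    ⟨φ.toLinearEquiv, Representation.IntertwiningMap.isIntertwining _ _ φ.toIntertwiningMap g₀⟩
  let f : (J → k) →ₗ[k] (I → k) := e.toLinearMap ∘ₗ ψ.symm.toLinearMap ∘ₗ d.symm.toLinearMap
  let g : (I → k) →ₗ[k] (J → k) := d.toLinearMap ∘ₗ ψ.toLinearMap ∘ₗ e.symm.toLinearMap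
  have hf : ∀ v, A.mulVec (f v) = f (B.mulVec v) := by
    intro v
    obtain ⟨w, rfl⟩ := d.surjective v
    obtain ⟨u, rfl⟩ := ψ.surjective w
    rw [← hd, ← hψ]
    simp only [f, LinearMap.comp_apply, LinearEquiv.coe_coe, LinearEquiv.symm_apply_apply, he]
  have hg : ∀ v, B.mulVec (g v) = g (A.mulVec v) := by
    intro v
    obtain ⟨u, rfl⟩ := e.surjective v
    rw [← he]
    simp only [g, LinearMap.comp_apply, LinearEquiv.coe_coe, LinearEquiv.symm_apply_apply, ← hd,
      hψ]
  refine ⟨LinearMap.toMatrix' f, LinearMap.toMatrix' g, ?_, ?_, ?_⟩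
  · refine Matrix.toLin'.injective (LinearMap.ext fun v => ?_)
    simp only [Matrix.toLin'_mul, Matrix.toLin'_toMatrix', LinearMap.comp_apply,
      Matrix.toLin'_apply, hf]
  · refine Matrix.toLin'.injective (LinearMap.ext fun v => ?_)
    simp only [Matrix.toLin'_mul, Matrix.toLin'_toMatrix', LinearMap.comp_apply,
      Matrix.toLin'_apply, hg]
  · rw [← LinearMap.toMatrix'_comp]
    have : g ∘ₗ f = LinearMap.id := LinearMap.ext fun v => by simp [f, g]
    rw [this, LinearMap.toMatrix'_id]

theorem bijective_comp_of_det_ne_zero {g₀ : G} (hg : ∀ g, g ∈ Subgroup.zpowers g₀)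
    {e : E ≃ₗ[k] (I → k)} {A : Matrix I I k} (he : ∀ v, e (ρ g₀ v) = A.mulVec (e v))
    {d : S ≃ₗ[k] (J → k)} {B : Matrix J J k} (hd : ∀ v, d (τ g₀ v) = B.mulVec (d v))
    {P : Matrix I J k} (hP : A * P = P * B) {Q : Matrix J I k} (hQ : B * Q = Q * A)
    (hdet : (Q * P).det ≠ 0) :
    Function.Bijective
      ((intertwiningOfMatrix hg hd he Q hQ).comp (intertwiningOfMatrix hg he hd P hP)) := by
  have h : ∀ v, d ((intertwiningOfMatrix hg hd he Q hQ).comp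
      (intertwiningOfMatrix hg he hd P hP) v) = (Q * P).mulVec (d v) := by
    intro v
    rw [Representation.IntertwiningMap.comp_apply, intertwiningOfMatrix_apply,
      intertwiningOfMatrix_apply, Matrix.mulVec_mulVec]
  have hu : IsUnit (Q * P) := (Matrix.isUnit_iff_isUnit_det _).2 (isUnit_iff_ne_zero.2 hdet)
  constructor
  · intro v w hvw
    apply d.injective
    apply Matrix.mulVec_injective_iff_isUnit.2 hu
    rw [← h, ← h, hvw]
  · intro w
    obtain ⟨v, hv⟩ := Matrix.mulVec_surjective_iff_isUnit.2 hu (d w)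
    refine ⟨d.symm v, d.injective ?_⟩
    rw [h, LinearEquiv.apply_symm_apply]
    exact hv

end coordinates

/-- Matrices that split off a sum of Jordan blocks define a direct summand with its decomposition
into indecomposables. -/
theorem exists_summands {k G E X : Type*} [Field k] [Group G] [AddCommGroup E] [Module k E]
    [Fintype X] [DecidableEq X] {I : Type*} [Fintype I] [DecidableEq I]
    {ρ : Representation k G E} {g₀ : G} (hg : ∀ g, g ∈ Subgroup.zpowers g₀)
    {e : E ≃ₗ[k] (I → k)} {A : Matrix I I k} (he : ∀ v, e (ρ g₀ v) = A.mulVec (e v)) {s : X → ℕ}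
    (hs : ∀ x, 1 ≤ s x) (τ : ∀ x, Representation k G (Fin (s x) → k))
    (hτ : ∀ x, τ x g₀ = Matrix.toLin' (sigmaMatrix k (s x)))
    {P : Matrix I (Σ x, Fin (s x)) k} (hP : A * P = P * blockSigma k s)
    {Q : Matrix (Σ x, Fin (s x)) I k} (hQ : blockSigma k s * Q = Q * A)
    (hdet : (Q * P).det ≠ 0) :
    ∃ (N : Subrepresentation ρ) (Nγ : X → Subrepresentation ρ), IsComplemented N ∧
      Nonempty (N.toRepresentation.Equiv (Representation.directSum τ)) ∧ IsInternalSum Nγ N ∧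
      (∀ x, IsIndecomposable (Nγ x).toRepresentation ∧
        Module.finrank k (Nγ x).toSubmodule = s x) ∧
      (∀ t, t ∈ N.toSubmodule ↔ ∃ w, (∀ j ∉ Set.univ, w j = 0) ∧ e t = P.mulVec w) ∧
      ∀ x t, t ∈ (Nγ x).toSubmodule ↔
        ∃ w, (∀ j ∉ {j : Σ x, Fin (s x) | j.1 = x}, w j = 0) ∧ e t = P.mulVec w := by
  have hd := sumCoord_directSum s τ hτ
  let f := intertwiningOfMatrix hg he hd P hP
  let g := intertwiningOfMatrix hg hd he Q hQ
  have hfe : ∀ v, e (f v) = P.mulVec (sumCoord k s v) := intertwiningOfMatrix_apply hg he hd P hP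
  have hgf : Function.Bijective (g.comp f) := bijective_comp_of_det_ne_zero hg he hd hP hQ hdet
  have hf : Function.Injective f :=
    Function.Injective.of_comp (f := g) hgf.1
  refine ⟨f.range, fun x => (blockMap f x).range, isComplemented_range f g hgf,
    nonempty_equiv_range f hf, isInternalSum_blockMap hf, fun x => ?_, fun t => ?_, fun x t => ?_⟩
  · obtain ⟨φ⟩ := nonempty_equiv_range _ (blockMap_injective hf x)
    constructor
    · refine isIndecomposable_of_jordan (g₀ := g₀) (hs x) φ.toLinearEquiv fun v => ?_
      have h := Representation.IntertwiningMap.isIntertwining _ _ φ.toIntertwiningMap g₀ v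
      rw [hτ] at h
      exact h
    · rw [φ.toLinearEquiv.finrank_eq, Module.finrank_fin_fun]
  · constructor
    · rintro ⟨v, rfl⟩
      exact ⟨sumCoord k s v, fun j hj => absurd (Set.mem_univ j) hj, hfe v⟩
    · rintro ⟨w, -, hw⟩
      refine ⟨(sumCoord k s).symm w, e.injective ?_⟩
      rw [hw]
      exact (hfe _).trans (by rw [LinearEquiv.apply_symm_apply])
  · constructor
    · rintro ⟨v, rfl⟩
      refine ⟨_, fun j hj => ?_, hfe (DirectSum.lof k X (fun x => Fin (s x) → k) x v)⟩
      exact sumCoord_lof s x v j.1 j.2 hj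
    · rintro ⟨w, hw, hw'⟩
      refine ⟨fun i => w ⟨x, i⟩, e.injective ?_⟩
      rw [hw']
      refine (hfe (DirectSum.lof k X (fun x => Fin (s x) → k) x fun i => w ⟨x, i⟩)).trans ?_
      rw [exists_lof_of_sumCoord_eq_zero s x w hw]

section blocks
variable {R : Type*} [CommRing R] {X Y I : Type*}

/-- The inclusion of the index set of some of the blocks. -/
def blockEmb (s : Y → ℕ) (φ : X → Y) : (Σ x, Fin (s (φ x))) → Σ y, Fin (s y) :=
  fun j => ⟨φ j.1, j.2⟩

theorem blockEmb_injective (s : Y → ℕ) {φ : X → Y} (hφ : Function.Injective φ) :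
    Function.Injective (blockEmb s φ) := by
  rintro ⟨x, i⟩ ⟨y, j⟩ h
  have h1 : φ x = φ y := congrArg Sigma.fst h
  obtain rfl := hφ h1
  have h2 : i = j := eq_of_heq (Sigma.mk.inj h).2
  rw [h2]

variable [Fintype X] [DecidableEq X] [Fintype Y] [DecidableEq Y]

/-- Only whole blocks are selected, and `blockSigma` mixes no two blocks. -/
theorem mul_blockSigma_submatrix (s : Y → ℕ) (φ : X → Y) (A : Matrix I (Σ y, Fin (s y)) R) :
    (A * blockSigma R s).submatrix id (blockEmb s φ) =
      A.submatrix id (blockEmb s φ) * blockSigma R fun x => s (φ x) := by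
  ext i ⟨x, l⟩
  rw [Matrix.submatrix_apply, Matrix.mul_apply, Matrix.mul_apply, Fintype.sum_sigma,
    Fintype.sum_sigma, Finset.sum_eq_single (φ x), Finset.sum_eq_single x]
  · simp [blockSigma, blockEmb, Matrix.blockDiagonal'_apply_eq]
  · intro y _ hy
    refine Finset.sum_eq_zero fun j _ => ?_
    rw [blockSigma, Matrix.blockDiagonal'_apply_ne _ _ _ hy, mul_zero]
  · simp
  · intro y _ hy
    refine Finset.sum_eq_zero fun j _ => ?_
    rw [blockSigma, blockEmb, Matrix.blockDiagonal'_apply_ne _ _ _ hy, mul_zero]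
  · simp

theorem blockSigma_mul_submatrix (s : Y → ℕ) (φ : X → Y) (A : Matrix (Σ y, Fin (s y)) I R) :
    (blockSigma R s * A).submatrix (blockEmb s φ) id =
      (blockSigma R fun x => s (φ x)) * A.submatrix (blockEmb s φ) id := by
  ext ⟨x, l⟩ i
  rw [Matrix.submatrix_apply, Matrix.mul_apply, Matrix.mul_apply, Fintype.sum_sigma,
    Fintype.sum_sigma, Finset.sum_eq_single (φ x), Finset.sum_eq_single x]
  · simp [blockSigma, blockEmb, Matrix.blockDiagonal'_apply_eq]
  · intro y _ hy
    refine Finset.sum_eq_zero fun j _ => ?_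
    rw [blockSigma, Matrix.blockDiagonal'_apply_ne _ _ _ hy.symm, zero_mul]
  · simp
  · intro y _ hy
    refine Finset.sum_eq_zero fun j _ => ?_
    rw [blockSigma, blockEmb, Matrix.blockDiagonal'_apply_ne _ _ _ hy.symm, zero_mul]
  · simp

end blocks

/-! ### Decomposition of `C_p`-modules over `𝔽_p`. -/

section existence
variable {p : ℕ} [Fact p.Prime]

theorem sub_one_pow_eq_zero_of_pow_eq_one {A : Type*} [Ring A] [Algebra (ZMod p) A] {x : A}
    (hx : x ^ p = 1) : (x - 1) ^ p = 0 := by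
  obtain ⟨c, hc⟩ := (Commute.one_right (x - 1)).exists_add_pow_prime_eq (Fact.out : p.Prime)
  have hp : (p : A) = 0 := by
    rw [← map_natCast (algebraMap (ZMod p) A), CharP.cast_eq_zero, map_zero]
  rw [sub_add_cancel, hx, one_pow, hp] at hc
  simp only [zero_mul, add_zero] at hc
  exact add_eq_right.1 hc.symm

theorem sigmaMatrix_mulVec_cast {R : Type*} [CommRing R] {m m' : ℕ} (h : m = m') (w : Fin m' → R)
    (i : Fin m) :
    (sigmaMatrix R m').mulVec w (Fin.cast h i) =
      (sigmaMatrix R m).mulVec (fun j => w (Fin.cast h j)) i := by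
  subst h
  rfl

/-- A representation of a cyclic group of order `p` over `𝔽_p` is a sum of Jordan blocks. -/
theorem exists_equiv_sumV {E : Type*} [AddCommGroup E] [Module (ZMod p) E]
    [FiniteDimensional (ZMod p) E] (ρ : Representation (ZMod p) (Multiplicative (ZMod p)) E) :
    ∃ a : ℕ → ℕ, Nonempty (ρ.Equiv (sumV p p le_rfl a)) := by
  set g₀ : Multiplicative (ZMod p) := Multiplicative.ofAdd 1 with hg₀
  have hpow : ρ g₀ ^ p = 1 := by
    rw [← map_pow, hg₀, ← ofAdd_nsmul, nsmul_one, CharP.cast_eq_zero, ofAdd_zero, map_one]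
  obtain ⟨X, _, s, e, hs, he⟩ :=
    exists_jordan_decomposition (ρ g₀ - 1) (sub_one_pow_eq_zero_of_pow_eq_one hpow)
  classical
  have hf : ∀ x, s x - 1 < p := fun x => by have := hs x; omega
  let f : X → Fin p := fun x => ⟨s x - 1, hf x⟩
  have hfs : ∀ (i : Fin p) x, f x = i ↔ s x = i + 1 := fun i x => by
    have := hs x
    rw [Fin.ext_iff]
    change s x - 1 = i ↔ _
    omega
  -- The multiplicity of each size; the fibre of `f` over `i` consists of the blocks of size `i +
  -- 1`.
  let a : ℕ → ℕ := fun m => Fintype.card {x // s x = m}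
  let ψ : X ≃ Σ i : Fin p, Fin (a (i + 1)) := (Equiv.sigmaFiberEquiv f).symm.trans
    (Equiv.sigmaCongrRight fun i => (Equiv.subtypeEquivRight (hfs i)).trans (Fintype.equivFin _))
  have hψ : ∀ y, (y.1 : ℕ) + 1 = s (ψ.symm y) := by
    intro y
    obtain ⟨x, rfl⟩ := ψ.surjective y
    rw [Equiv.symm_apply_apply]
    change s x - 1 + 1 = s x
    have := hs x
    omega
  let L : E ≃ₗ[ZMod p] ⨁ y : (Σ i : Fin p, Fin (a (i + 1))), (Fin (y.1 + 1) → ZMod p) :=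
    ((e.trans (LinearEquiv.piCongrLeft' (ZMod p) (fun x => Fin (s x) → ZMod p) ψ)).trans
      (LinearEquiv.piCongrRight fun y =>
        LinearEquiv.funCongrLeft (ZMod p) (ZMod p) (finCongr (hψ y)))).trans
      (DirectSum.linearEquivFunOnFintype (ZMod p) _ _).symm
  have hL : ∀ v y i, L v y i = e v (ψ.symm y) (Fin.cast (hψ y) i) := fun v y i => rfl
  refine ⟨a, ⟨Representation.Equiv.mk L fun g => LinearMap.ext fun v => ?_⟩⟩
  refine commutes_of_generator (ρ := sumV p p le_rfl a) (f := L.toLinearMap)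
    (mem_zpowers_ofAdd_one_zmod p) (fun v => ?_) g v
  ext y i
  have h1 : ρ g₀ v = (ρ g₀ - 1) v + v := by simp
  change L (ρ g₀ v) y i = _
  rw [hL, h1, map_add, Pi.add_apply, he, Matrix.sub_mulVec, Matrix.one_mulVec, sub_add_cancel,
    sigmaMatrix_mulVec_cast]
  have h2 : sumV p p le_rfl a g₀ (L v) y = V p (y.1 + 1) y.1.isLt g₀ (L v y) := by
    rw [sumV, Representation.directSum_apply, DirectSum.lmap_apply]
  refine Eq.trans ?_ (congrFun h2 i).symm
  rw [hg₀, V_generator]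
  rfl

end existence

end CyclicTensor

end

/-! ### The main theorem. -/

theorem mainTheorem6 (p : ℕ) [Fact p.Prime] (r : ℕ) (n : Fin r → ℕ)
    (hn : ∀ k, 1 ≤ n k ∧ n k ≤ p) :
    (∃ a : ℕ → ℕ, Nonempty
      ((CyclicTensor.tensorRep fun k => CyclicTensor.V p (n k) (hn k).2).Equiv
        (CyclicTensor.sumV p p le_rfl a))) ∧
    ∀ a : ℕ → ℕ,
      Nonempty ((CyclicTensor.tensorRep fun k => CyclicTensor.V p (n k) (hn k).2).Equiv
        (CyclicTensor.sumV p p le_rfl a)) →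
      ∃ (N : Subrepresentation (CyclicTensor.tensorRep fun k => CyclicTensor.M (n k)))
        (W : Subrepresentation
          (CyclicTensor.tensorRep fun k => CyclicTensor.V p (n k) (hn k).2)),
        IsComplemented N ∧
        Nonempty (N.toRepresentation.Equiv (CyclicTensor.sumM (p - 1) a)) ∧
        IsComplemented W ∧
        Nonempty (W.toRepresentation.Equiv (CyclicTensor.sumV p (p - 1) (Nat.sub_le p 1) a)) ∧
        CyclicTensor.reduction p N.toSubmodule = W.toSubmodule.toAddSubgroup ∧
        ∃ (Γ : Type) (_ : Finite Γ)
          (Nγ : Γ → Subrepresentation (CyclicTensor.tensorRep fun k => CyclicTensor.M (n k)))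
          (Wγ : Γ → Subrepresentation
            (CyclicTensor.tensorRep fun k => CyclicTensor.V p (n k) (hn k).2)),
          CyclicTensor.IsInternalSum Nγ N ∧
          CyclicTensor.IsInternalSum Wγ W ∧
          ∀ γ,
            CyclicTensor.IsIndecomposable (Nγ γ).toRepresentation ∧
            CyclicTensor.IsIndecomposable (Wγ γ).toRepresentation ∧
            Module.finrank ℚ (Nγ γ).toSubmodule = Module.finrank (ZMod p) (Wγ γ).toSubmodule ∧
            CyclicTensor.reduction p (Nγ γ).toSubmodule =
              (Wγ γ).toSubmodule.toAddSubgroup := by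
  open CyclicTensor in
  have hfin : FiniteDimensional (ZMod p) (⨂[ZMod p] k, (Fin (n k) → ZMod p)) :=
    Module.Finite.equiv (tensorCoord (ZMod p) n).symm
  refine ⟨exists_equiv_sumV _, fun a ⟨φ⟩ => ?_⟩
  let s : (Σ i : Fin p, Fin (a (i + 1))) → ℕ := fun y => y.1 + 1
  -- Selects the blocks of size less than `p`; the free blocks are dropped.
  let ι : (Σ i : Fin (p - 1), Fin (a (i + 1))) → Σ i : Fin p, Fin (a (i + 1)) :=
    fun x => ⟨Fin.castLE (Nat.sub_le p 1) x.1, x.2⟩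
  have hι : Function.Injective ι := by
    rintro ⟨i, u⟩ ⟨j, w⟩ h
    have h1 : i = j := Fin.castLE_injective (Nat.sub_le p 1) (congrArg Sigma.fst h)
    subst h1
    have h2 : u = w := eq_of_heq (Sigma.mk.inj h).2
    rw [h2]
  let s' : (Σ i : Fin (p - 1), Fin (a (i + 1))) → ℕ := fun x => x.1 + 1
  have hs' : ∀ x, s' x ≤ p - 1 := fun x => x.1.isLt
  have hV := tensorCoord_tensorRep_V p n fun k => (hn k).2
  have hM := tensorCoord_tensorRep_M n
  have hredK : red p (tensorMatrix ℤ n) = tensorMatrix (ZMod p) n :=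
    map_castRingHom_tensorMatrix (ZMod p) n
  obtain ⟨A, B, hA, hB, hBA⟩ := exists_matrices_of_equiv hV
    (sumCoord_directSum s (fun y => V p (y.1 + 1) y.1.isLt) fun y => V_generator p _) φ
  obtain ⟨P, Q, hP, hQ, hdet⟩ := (isStablyJordan_tensorMatrix n hn).exists_split_lift
    (isShift_blockSigma s') (f := A.submatrix id (blockEmb s ι))
    (g := B.submatrix (blockEmb s ι) id)
    (by rw [red_blockSigma]; exact blockSigma_sub_one_pow s' _ hs')
    (by
      rw [red_blockSigma, hredK]
      refine Eq.trans ?_ (mul_blockSigma_submatrix s ι A)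
      rw [← hA]
      rfl)
    (by
      rw [red_blockSigma, hredK]
      refine (blockSigma_mul_submatrix s ι B).symm.trans ?_
      rw [hB]
      rfl)
    (by
      rw [← Matrix.submatrix_mul _ _ _ _ _ Function.bijective_id, hBA]
      exact Matrix.submatrix_one _ (blockEmb_injective s hι))
  -- The same integral pair `P`, `Q` provides the splitting over `ℚ` and over `𝔽_p`.
  have hdetR : ∀ (R : Type) [CommRing R], ((Q.map (Int.castRingHom R)) *
      (P.map (Int.castRingHom R))).det = ((Q * P).det : R) := by
    intro R _
    rw [← Matrix.map_mul]
    exact (Int.cast_det _).symm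
  have hPR : ∀ (R : Type) [CommRing R], tensorMatrix R n * P.map (Int.castRingHom R) =
      P.map (Int.castRingHom R) * blockSigma R s' := by
    intro R _
    rw [← map_castRingHom_tensorMatrix, ← map_castRingHom_blockSigma, ← Matrix.map_mul, hP,
      Matrix.map_mul]
  have hQR : ∀ (R : Type) [CommRing R], blockSigma R s' * Q.map (Int.castRingHom R) =
      Q.map (Int.castRingHom R) * tensorMatrix R n := by
    intro R _
    rw [← map_castRingHom_tensorMatrix, ← map_castRingHom_blockSigma, ← Matrix.map_mul, hQ,
      Matrix.map_mul]
  have hdetQ : ((Q * P).det : ℚ) ≠ 0 := by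
    intro h
    rw [Int.cast_eq_zero.1 h, Int.cast_zero] at hdet
    exact hdet rfl
  obtain ⟨N, Nγ, hN1, hN2, hN3, hN4, hN5, hN6⟩ := exists_summands mem_zpowers_ofAdd_one_int hM
    (fun x => Nat.le_add_left 1 _) (fun x => M (x.1 + 1)) (fun x => M_generator _)
    (hPR ℚ) (hQR ℚ) (by rw [hdetR]; exact hdetQ)
  obtain ⟨W, Wγ, hW1, hW2, hW3, hW4, hW5, hW6⟩ := exists_summands (mem_zpowers_ofAdd_one_zmod p) hV
    (fun x => Nat.le_add_left 1 _)
    (fun x => V p (x.1 + 1) (le_trans x.1.isLt (Nat.sub_le p 1))) (fun x => V_generator p _)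
    (hPR (ZMod p)) (hQR (ZMod p)) (by rw [hdetR]; exact hdet)
  refine ⟨N, W, hN1, hN2, hW1, hW2, reduction_eq hdet Set.univ hN5 hW5, _, inferInstance, Nγ, Wγ,
    hN3, hW3, fun x => ⟨(hN4 x).1, (hW4 x).1, (hN4 x).2.trans (hW4 x).2.symm,
      reduction_eq hdet _ (hN6 x) (hW6 x)⟩⟩
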